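/- Work over $\mathbb{C}$. By a variety in $\mathbb{P}^N$ we mean an irreducible Zariski closed subset. For points $p=(p_0:\cdots:p_N)$ and $q=(q_0:\cdots:q_N)$ of $\mathbb{P}^N$ put $p\star q=(p_0q_0:\cdots:p_Nq_N)$, which is defined when some $p_iq_i$ is nonzero. For varieties $X,Y\subset\mathbb{P}^N$ let $X\star Y\subset\mathbb{P}^N$ be the Zariski closure of $\{p\star q : p\in X,\ q\in Y,\ p\star q \text{ defined}\}$, and let $h_{X,Y}\colon X\times Y\dashrightarrow X\star Y$ be the rational map $(p,q)\mapsto p\star q$. We say that $h_{X,Y}$ is an isomorphism if it extends to an isomorphism of varieties $X\times Y\to X\star Y$ (in particular, $p\star q$ has to be defined for some $(p,q)\in X\times Y$). **Proposition.** Let $N$ and $d$ be integers with $1\le d<N/2$, let $X\subset\mathbb{P}^N$ be a variety of dimension $d$, and let $Y\subset\mathbb{P}^N$ be a variety of codimension $d+1$. Then $h_{X,Y}$ is an isomorphism if and only if $N=3$, $X$ and $Y$ are both lines in $\mathbb{P}^3$, and $X\star Y$ is a quadric surface (an irreducible surface of degree $2$, i.e. the zero set of an irreducible quadratic form). -/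

import Mathlib

open MvPolynomial

/-- Complex projective space of dimension `N`: the lines through the origin in `ℂ^(N+1)`. -/
def ProjSpace (N : ℕ) : Type := Projectivization ℂ (Fin (N + 1) → ℂ)

namespace ProjSpace

variable {N M : ℕ}

/-- The point `(v₀ : ⋯ : v_N)` with homogeneous coordinate vector `v ≠ 0`. -/
noncomputable def mk (v : Fin (N + 1) → ℂ) (hv : v ≠ 0) : ProjSpace N := Projectivization.mk ℂ v hv

/-- A choice of homogeneous coordinates of a point. -/
noncomputable def coords (p : ProjSpace N) : Fin (N + 1) → ℂ := Projectivization.rep p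

theorem coords_ne_zero (p : ProjSpace N) : p.coords ≠ 0 := Projectivization.rep_nonzero p

theorem mk_coords (p : ProjSpace N) : mk p.coords p.coords_ne_zero = p :=
  Projectivization.mk_rep p

theorem mk_eq_mk_iff {v w : Fin (N + 1) → ℂ} (hv : v ≠ 0) (hw : w ≠ 0) :
    mk v hv = mk w hw ↔ ∃ a : ℂ, a • w = v :=
  Projectivization.mk_eq_mk_iff' ℂ v w hv hw

/-- The chosen coordinates of `(v₀ : ⋯ : v_N)` are a nonzero multiple of `v`. -/
theorem exists_coords_mk (v : Fin (N + 1) → ℂ) (hv : v ≠ 0) :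
    ∃ a : ℂ, a ≠ 0 ∧ (mk v hv).coords = a • v := by
  obtain ⟨a, ha⟩ := (mk_eq_mk_iff _ hv).1 (mk_coords (mk v hv))
  refine ⟨a, ?_, ha.symm⟩
  rintro rfl
  exact coords_ne_zero (mk v hv) (by rw [← ha, zero_smul])

/-- The common zeros in `ℙ^N` of a set of (homogeneous) polynomials. -/
def zeroLocus (S : Set (MvPolynomial (Fin (N + 1)) ℂ)) : Set (ProjSpace N) :=
  {p | ∀ F ∈ S, eval p.coords F = 0}

/-- The vanishing of a homogeneous polynomial at a point does not depend on the coordinates. -/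
theorem eval_coords_mk_eq_zero_iff {F : MvPolynomial (Fin (N + 1)) ℂ} {n : ℕ}
    (hF : F.IsHomogeneous n) (v : Fin (N + 1) → ℂ) (hv : v ≠ 0) :
    eval (mk v hv).coords F = 0 ↔ eval v F = 0 := by
  obtain ⟨a, ha, h⟩ := exists_coords_mk v hv
  have key : eval (a • v) F = a ^ n * eval v F := by
    rw [eval_eq, eval_eq, Finset.mul_sum]
    refine Finset.sum_congr rfl fun e he => ?_
    have hdeg : ∑ i ∈ e.support, e i = n := by
      rw [← hF (mem_support_iff.1 he), Finsupp.weight_apply, Finsupp.sum]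
      simp
    simp only [Pi.smul_apply, smul_eq_mul, mul_pow, Finset.prod_mul_distrib,
      Finset.prod_pow_eq_pow_sum, hdeg]
    ring
  rw [h, key, mul_eq_zero, or_iff_right (pow_ne_zero n ha)]

/-- Zero loci of sets of homogeneous polynomials. -/
def IsAlgebraicSet (Z : Set (ProjSpace N)) : Prop :=
  ∃ S : Set (MvPolynomial (Fin (N + 1)) ℂ), (∀ F ∈ S, ∃ n, F.IsHomogeneous n) ∧ Z = zeroLocus S

/-- The Zariski topology on `ℙ^N`: the closed sets are the algebraic sets. -/
instance zariskiTopology : TopologicalSpace (ProjSpace N) :=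
  TopologicalSpace.ofClosed {Z | IsAlgebraicSet Z}
    ⟨{1}, by simpa using ⟨0, isHomogeneous_one _ _⟩, by simp [zeroLocus]⟩
    (by
      intro A hA
      have hA' : ∀ Z ∈ A, IsAlgebraicSet Z := fun Z hZ => hA hZ
      choose! S hS hZ using hA'
      refine ⟨⋃ Z ∈ A, S Z, ?_, ?_⟩
      · intro F hF
        simp only [Set.mem_iUnion] at hF
        obtain ⟨Z, hZA, hF⟩ := hF
        exact hS Z hZA F hF
      · ext p
        simp only [Set.mem_sInter, zeroLocus, Set.mem_iUnion, Set.mem_ofPred_eq]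
        constructor
        · rintro h F ⟨Z, hZA, hF⟩
          have := h Z hZA
          rw [hZ Z hZA] at this
          exact this F hF
        · intro h Z hZA
          rw [hZ Z hZA]
          exact fun F hF => h F ⟨Z, hZA, hF⟩)
    (by
      rintro _ ⟨S, hS, rfl⟩ _ ⟨T, hT, rfl⟩
      refine ⟨{H | ∃ F ∈ S, ∃ G ∈ T, H = F * G}, ?_, ?_⟩
      · rintro _ ⟨F, hF, G, hG, rfl⟩
        obtain ⟨m, hm⟩ := hS F hF
        obtain ⟨n, hn⟩ := hT G hG
        exact ⟨m + n, hm.mul hn⟩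
      · ext p
        constructor
        · rintro (h | h) _ ⟨F, hF, G, hG, rfl⟩
          · simp [h F hF]
          · simp [h G hG]
        · intro h
          by_contra hc
          simp only [Set.mem_union, zeroLocus, Set.mem_ofPred_eq, not_or, not_forall] at hc
          obtain ⟨⟨F, hF, hF0⟩, G, hG, hG0⟩ := hc
          have := h _ ⟨F, hF, G, hG, rfl⟩
          rw [map_mul] at this
          exact (mul_ne_zero hF0 hG0) this)

theorem isClosed_iff (Z : Set (ProjSpace N)) : IsClosed Z ↔ IsAlgebraicSet Z :=
  isOpen_compl_iff.symm.trans (by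
    change IsAlgebraicSet Zᶜᶜ ↔ _
    rw [compl_compl])

/-- Projective varieties: irreducible (hence nonempty) Zariski closed subsets of `ℙ^N`. -/
structure IsVariety (X : Set (ProjSpace N)) : Prop where
  isClosed : IsClosed X
  isIrreducible : IsIrreducible X

/-- The dimension of a subset of `ℙ^N`, i.e. the Krull dimension of its Zariski topology. -/
noncomputable def dim (X : Set (ProjSpace N)) : WithBot ℕ∞ := topologicalKrullDim X

/-- `X` has codimension `c` in `ℙ^N`. -/
def HasCodim (X : Set (ProjSpace N)) (c : ℕ) : Prop := dim X + (c : WithBot ℕ∞) = (N : WithBot ℕ∞)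

/-- Lines of `ℙ^N`, i.e. projectivizations of `2`-dimensional linear subspaces. -/
def IsLine (X : Set (ProjSpace N)) : Prop :=
  ∃ E : Submodule ℂ (Fin (N + 1) → ℂ), Module.finrank ℂ E = 2 ∧ X = {p | p.coords ∈ E}

/-- `W` is an (irreducible) quadric hypersurface of `ℙ^N`, i.e. an irreducible hypersurface of
degree two; for `N = 3` these are the quadric surfaces. -/
def IsQuadric (W : Set (ProjSpace N)) : Prop :=
  ∃ F : MvPolynomial (Fin (N + 1)) ℂ, F.IsHomogeneous 2 ∧ Irreducible F ∧ W = zeroLocus {F}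

/-- `p ⋆ q` exists: the coordinatewise product of coordinates of `p` and `q` is nonzero. -/
def HadamardDefined (p q : ProjSpace N) : Prop := p.coords * q.coords ≠ 0

/-- The Hadamard product `p ⋆ q = (p₀q₀ : ⋯ : p_Nq_N)` of two points, where it exists. -/
noncomputable def hadamardPoint (p q : ProjSpace N) (h : HadamardDefined p q) : ProjSpace N :=
  mk (p.coords * q.coords) h

theorem hadamardDefined_mk_iff (v w : Fin (N + 1) → ℂ) (hv : v ≠ 0) (hw : w ≠ 0) :
    HadamardDefined (mk v hv) (mk w hw) ↔ v * w ≠ 0 := by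
  obtain ⟨a, ha, h⟩ := exists_coords_mk v hv
  obtain ⟨b, hb, h'⟩ := exists_coords_mk w hw
  rw [HadamardDefined, h, h', smul_mul_smul_comm]
  simp [ha, hb]

theorem hadamardPoint_mk (v w : Fin (N + 1) → ℂ) (hv : v ≠ 0) (hw : w ≠ 0)
    (h : HadamardDefined (mk v hv) (mk w hw)) (hvw : v * w ≠ 0) :
    hadamardPoint (mk v hv) (mk w hw) h = mk (v * w) hvw := by
  obtain ⟨a, ha, e⟩ := exists_coords_mk v hv
  obtain ⟨b, hb, e'⟩ := exists_coords_mk w hw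
  exact (mk_eq_mk_iff _ _).2 ⟨a * b, by rw [e, e', smul_mul_smul_comm]⟩

/-- The Hadamard product `X ⋆ Y`: the Zariski closure of
`{p ⋆ q | p ∈ X, q ∈ Y, p ⋆ q exists}`. -/
def hadamardProduct (X Y : Set (ProjSpace N)) : Set (ProjSpace N) :=
  closure {r | ∃ p ∈ X, ∃ q ∈ Y, ∃ h : HadamardDefined p q, r = hadamardPoint p q h}

/-- A map `f : X → ℙ^M` on a subset `X` of `ℙ^N` is regular if, around each point of `X`, it is
given by `M + 1` homogeneous polynomials of the same degree.  (After multiplying the polynomials by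
a form which vanishes off a neighbourhood where the formula holds, that neighbourhood may be taken
to be the set of points of `X` at which they do not vanish simultaneously.) -/
def IsRegular (X : Set (ProjSpace N)) (f : X → ProjSpace M) : Prop :=
  ∀ x : X, ∃ (n : ℕ) (G : Fin (M + 1) → MvPolynomial (Fin (N + 1)) ℂ),
    (∀ j, (G j).IsHomogeneous n) ∧
    (fun j => eval x.1.coords (G j)) ≠ 0 ∧
    ∀ (z : X) (hz : (fun j => eval z.1.coords (G j)) ≠ 0), f z = mk _ hz

/-- Bihomogeneous polynomials of bidegree `(a, b)` in two sets of `N + 1` variables. -/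
def IsBihomogeneous (F : MvPolynomial (Fin (N + 1) ⊕ Fin (N + 1)) ℂ) (a b : ℕ) : Prop :=
  IsWeightedHomogeneous
    (Sum.elim (fun _ => (1, 0)) (fun _ => (0, 1)) : Fin (N + 1) ⊕ Fin (N + 1) → ℕ × ℕ) F (a, b)

/-- A map `f : X × Y → ℙ^M`, where `X, Y ⊆ ℙ^N`, is regular if, around each point of `X × Y`, it is
given by `M + 1` bihomogeneous polynomials of the same bidegree. -/
def IsRegularOnProd (X Y : Set (ProjSpace N)) (f : X × Y → ProjSpace M) : Prop :=
  ∀ x : X × Y, ∃ (a b : ℕ) (G : Fin (M + 1) → MvPolynomial (Fin (N + 1) ⊕ Fin (N + 1)) ℂ),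
    (∀ j, IsBihomogeneous (G j) a b) ∧
    (fun j => eval (Sum.elim x.1.1.coords x.2.1.coords) (G j)) ≠ 0 ∧
    ∀ (z : X × Y) (hz : (fun j => eval (Sum.elim z.1.1.coords z.2.1.coords) (G j)) ≠ 0),
      f z = mk _ hz

/-- The Hadamard map `h_{X,Y} : X × Y ⇢ X ⋆ Y`, `(p, q) ↦ p ⋆ q`, is an isomorphism: this rational
map extends to a bijective regular map `X × Y → X ⋆ Y` whose inverse (a map to a product, so given
by its two components) is regular. -/
def HadamardMapIsIso (X Y : Set (ProjSpace N)) : Prop :=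
  ∃ e : X × Y ≃ hadamardProduct X Y,
    (∀ (x : X) (y : Y) (h : HadamardDefined x.1 y.1),
      (e (x, y) : ProjSpace N) = hadamardPoint x.1 y.1 h) ∧
    IsRegularOnProd X Y (fun z => (e z : ProjSpace N)) ∧
    IsRegular (hadamardProduct X Y) (fun w => ((e.symm w).1 : ProjSpace N)) ∧
    IsRegular (hadamardProduct X Y) (fun w => ((e.symm w).2 : ProjSpace N))

end ProjSpace

/-! An isomorphism embeds `X × Y` in `ℙ^N`, where closed sets of complementary dimension must meet.
Put `m = dim Y = N - d - 1`. Two slices `{x} × Y` have disjoint images, so `2m + 2 ≤ N + 1`; with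
`2d < N` this forces `m = d` and `N = 2d + 1`. A slice `X × {y}` and some `X × B` with `y ∉ B`, `dim
B ≥ m - 1`, are also disjoint, which forces `d = 1`, hence `N = 3` (`HadamardMapIsIso.eq_three`).
The bound itself (`length_add_length_le_of_disjoint`) is reduction to the diagonal on the product of
the affine cones. Applied inside a coordinate hyperplane, the first count also shows that `X` and
`Y` lie in none, and then `p ⋆ q` is defined for all `p`, `q`.

For curves in `ℙ³` the Hilbert functions decide. Let `T` be the span of the functions `x i * y j` on
the product of the cones and `L` that of the `x i * y i`. Definedness everywhere gives `T ^ (k + 1)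
= L * T ^ k` for large `k`; regularity of the inverse gives `L ^ s * T ≤ L ^ (s + 1)`. Hence `T ^ k
= L ^ k` eventually (`exists_finrank_hadamard_eq`), so the Hilbert function of `X ⋆ Y` is eventually
the product of those of the curves, `(a k + c)(b k + c')`. A cubic is impossible, so `X ⋆ Y` is a
surface of some degree `e`, and comparing polynomials leaves only `e = 2`, `a = b = c = c' = 1`
(`eq_one_of_hilbert_eq`). A curve with eventual Hilbert function `k + 1` is a line.

Conversely, a quadric lies in no plane, so if the lines are spanned by `a i` and `c j`, the four
products `a i * c j` form a basis of `ℂ⁴`. In this basis the Hadamard map is the Segre embedding of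
`ℙ¹ × ℙ¹`, whose inverse is given by linear forms. -/

/-! ### Scaling and homogeneous components -/

theorem MvPolynomial.IsHomogeneous.eval_smul {σ : Type*} {F : MvPolynomial σ ℂ} {n : ℕ}
    (hF : F.IsHomogeneous n) (a : ℂ) (v : σ → ℂ) : eval (a • v) F = a ^ n * eval v F := by
  rw [eval_eq, eval_eq, Finset.mul_sum]
  refine Finset.sum_congr rfl fun e he => ?_
  have hdeg : ∑ i ∈ e.support, e i = n := by
    rw [← hF (mem_support_iff.1 he), Finsupp.weight_apply, Finsupp.sum]
    simp
  simp only [Pi.smul_apply, smul_eq_mul, mul_pow, Finset.prod_mul_distrib,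
    Finset.prod_pow_eq_pow_sum, hdeg]
  ring

/-- A polynomial in `t` with vector coefficients which vanishes for all `t` has zero
coefficients. -/
theorem eq_zero_of_forall_sum_pow_mul_eq_zero {s : Finset ℕ} {c : ℕ → ℂ}
    (h : ∀ t : ℂ, ∑ k ∈ s, t ^ k * c k = 0) {k : ℕ} (hk : k ∈ s) : c k = 0 := by
  classical
  have hp : (∑ k ∈ s, Polynomial.monomial k (c k)) = 0 := by
    refine Polynomial.funext fun t => ?_
    rw [Polynomial.eval_finsetSum, Polynomial.eval_zero, ← h t]
    exact Finset.sum_congr rfl fun i _ => by rw [Polynomial.eval_monomial, mul_comm]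
  have := congrArg (fun p => Polynomial.coeff p k) hp
  simpa [Polynomial.finsetSum_coeff, Polynomial.coeff_monomial, hk] using this

theorem MvPolynomial.eval_smul_eq_sum {σ : Type*} (f : MvPolynomial σ ℂ) (t : ℂ) (v : σ → ℂ) :
    eval (t • v) f =
      ∑ k ∈ Finset.range (f.totalDegree + 1), t ^ k * eval v (homogeneousComponent k f) := by
  conv_lhs => rw [← sum_homogeneousComponent f, map_sum]
  exact Finset.sum_congr rfl fun k _ => (homogeneousComponent_isHomogeneous k f).eval_smul t v

theorem MvPolynomial.homogeneousComponent_eq_zero_of_notMem {σ : Type*} (f : MvPolynomial σ ℂ)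
    {k : ℕ} (hk : k ∉ Finset.range (f.totalDegree + 1)) : homogeneousComponent k f = 0 :=
  homogeneousComponent_eq_zero k f (by simpa [Nat.lt_succ_iff] using hk)

/-- If `f` vanishes on a set stable under scaling then so do its homogeneous components. -/
theorem MvPolynomial.eval_homogeneousComponent_eq_zero {σ : Type*} {v : σ → ℂ}
    {f : MvPolynomial σ ℂ} (hf : ∀ t : ℂ, eval (t • v) f = 0) (k : ℕ) :
    eval v (homogeneousComponent k f) = 0 := by
  by_cases hk : k ∈ Finset.range (f.totalDegree + 1)
  · exact eq_zero_of_forall_sum_pow_mul_eq_zero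
      (fun t => (f.eval_smul_eq_sum t v).symm.trans (hf t)) hk
  · rw [f.homogeneousComponent_eq_zero_of_notMem hk, map_zero]

theorem MvPolynomial.homogeneousComponent_mul_of_isHomogeneous {σ : Type*}
    {p : MvPolynomial σ ℂ} {m : ℕ} (hp : p.IsHomogeneous m) (q : MvPolynomial σ ℂ) (k : ℕ) :
    homogeneousComponent (m + k) (p * q) = p * homogeneousComponent k q := by
  classical
  conv_lhs => rw [← sum_homogeneousComponent q, Finset.mul_sum, map_sum]
  have h : ∀ i, homogeneousComponent (m + k) (p * homogeneousComponent i q) =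
      if i = k then p * homogeneousComponent i q else 0 := fun i => by
    rw [homogeneousComponent_of_mem (hp.mul (homogeneousComponent_isHomogeneous i q))]
    simp [eq_comm]
  simp_rw [h]
  rw [Finset.sum_ite_eq']
  split_ifs with hk
  · rfl
  · rw [q.homogeneousComponent_eq_zero_of_notMem hk, mul_zero]

/-! ### Affine cones and their ideals -/

namespace ProjSpace

variable {N M : ℕ}

/-- The affine cone over a subset of projective space. -/
def cone (X : Set (ProjSpace N)) : Set (Fin (N + 1) → ℂ) := {v | ∀ hv : v ≠ 0, mk v hv ∈ X}

theorem mem_cone_iff {X : Set (ProjSpace N)} {v : Fin (N + 1) → ℂ} (hv : v ≠ 0) :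
    v ∈ cone X ↔ mk v hv ∈ X := ⟨fun h => h hv, fun h _ => h⟩

theorem zero_mem_cone (X : Set (ProjSpace N)) : (0 : Fin (N + 1) → ℂ) ∈ cone X :=
  fun h => absurd rfl h

theorem coords_mem_cone {X : Set (ProjSpace N)} {p : ProjSpace N} : p.coords ∈ cone X ↔ p ∈ X := by
  rw [mem_cone_iff p.coords_ne_zero, mk_coords]

theorem mk_smul {v : Fin (N + 1) → ℂ} {a : ℂ} (h : a • v ≠ 0) (hv : v ≠ 0) :
    mk (a • v) h = mk v hv := (mk_eq_mk_iff _ _).2 ⟨a, rfl⟩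

theorem smul_mem_cone {X : Set (ProjSpace N)} {v : Fin (N + 1) → ℂ} (hv : v ∈ cone X) (a : ℂ) :
    a • v ∈ cone X := by
  intro h
  have hv0 : v ≠ 0 := fun h0 => h (by rw [h0, smul_zero])
  rw [mk_smul h hv0]
  exact hv hv0

theorem cone_mono {X Y : Set (ProjSpace N)} (h : X ⊆ Y) : cone X ⊆ cone Y :=
  fun _ hv h0 => h (hv h0)

theorem subset_of_cone_subset {X Y : Set (ProjSpace N)} (h : cone X ⊆ cone Y) : X ⊆ Y :=
  fun _ hp => coords_mem_cone.1 (h (coords_mem_cone.2 hp))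

theorem isClosed_setOf_eval_eq_zero {F : MvPolynomial (Fin (N + 1)) ℂ} {n : ℕ}
    (hF : F.IsHomogeneous n) : IsClosed {p : ProjSpace N | eval p.coords F = 0} :=
  (isClosed_iff _).2 ⟨{F}, by simpa using ⟨n, hF⟩, by ext; simp [zeroLocus]⟩

theorem isClosed_setOf_coords_eq_zero (i : Fin (N + 1)) :
    IsClosed {p : ProjSpace N | p.coords i = 0} := by
  simpa using isClosed_setOf_eval_eq_zero (isHomogeneous_X ℂ i)

theorem coords_mk_eq_zero_iff {v : Fin (N + 1) → ℂ} (hv : v ≠ 0) (i : Fin (N + 1)) :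
    (mk v hv).coords i = 0 ↔ v i = 0 := by
  simpa using eval_coords_mk_eq_zero_iff (isHomogeneous_X ℂ i) v hv

/-- A point outside a closed set is separated from it by a homogeneous polynomial. -/
theorem exists_isHomogeneous_of_notMem {X : Set (ProjSpace N)} (hX : IsClosed X) {p : ProjSpace N}
    (hp : p ∉ X) : ∃ (n : ℕ) (F : MvPolynomial (Fin (N + 1)) ℂ), F.IsHomogeneous n ∧
      (∀ v ∈ cone X, eval v F = 0) ∧ eval p.coords F ≠ 0 := by
  obtain ⟨S, hS, rfl⟩ := (isClosed_iff X).1 hX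
  simp only [zeroLocus, Set.mem_ofPred_eq, not_forall] at hp
  obtain ⟨F, hF, hpF⟩ := hp
  obtain ⟨n, hn⟩ := hS F hF
  obtain ⟨i, hi⟩ : ∃ i, p.coords i ≠ 0 := Function.ne_iff.1 p.coords_ne_zero
  -- The factor `X i` makes the form vanish at the origin, which lies in every cone, even when `F`
  -- is a constant.
  refine ⟨n + 1, F * X i, hn.mul (isHomogeneous_X ℂ i), fun v hv => ?_, by simp [hpF, hi]⟩
  by_cases hv0 : v = 0
  · simp [hv0]
  · have := (mem_cone_iff hv0).1 hv F hF
    rw [eval_coords_mk_eq_zero_iff hn] at this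
    simp [this]

theorem mem_cone_iff_forall_eval {X : Set (ProjSpace N)} (hX : IsClosed X) {v : Fin (N + 1) → ℂ} :
    v ∈ cone X ↔ ∀ f : MvPolynomial (Fin (N + 1)) ℂ, (∀ w ∈ cone X, eval w f = 0) →
      eval v f = 0 := by
  refine ⟨fun hv f hf => hf v hv, fun h hv => ?_⟩
  by_contra hp
  obtain ⟨n, F, hF, hFX, hFp⟩ := exists_isHomogeneous_of_notMem hX hp
  exact hFp ((eval_coords_mk_eq_zero_iff hF v hv).2 (h F hFX))

/-- The ideal of polynomials which vanish on the affine cone over `X`. -/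
noncomputable def coneIdeal (X : Set (ProjSpace N)) : Ideal (MvPolynomial (Fin (N + 1)) ℂ) :=
  vanishingIdeal ℂ (cone X)

theorem mem_coneIdeal {X : Set (ProjSpace N)} {f : MvPolynomial (Fin (N + 1)) ℂ} :
    f ∈ coneIdeal X ↔ ∀ v ∈ cone X, eval v f = 0 := by
  simp [coneIdeal, aeval_eq_eval]

theorem homogeneousComponent_mem_coneIdeal {X : Set (ProjSpace N)}
    {f : MvPolynomial (Fin (N + 1)) ℂ} (hf : f ∈ coneIdeal X) (k : ℕ) :
    homogeneousComponent k f ∈ coneIdeal X :=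
  mem_coneIdeal.2 fun _ hv =>
    eval_homogeneousComponent_eq_zero (fun t => mem_coneIdeal.1 hf _ (smul_mem_cone hv t)) k

/-- Nonemptiness excludes nonzero constants: these would vanish vacuously on the empty set but not
at the origin of its cone. -/
theorem mem_coneIdeal_of_isHomogeneous {X : Set (ProjSpace N)} (hX : X.Nonempty)
    {f : MvPolynomial (Fin (N + 1)) ℂ} {n : ℕ} (hf : f.IsHomogeneous n)
    (h : ∀ p ∈ X, eval p.coords f = 0) : f ∈ coneIdeal X := by
  refine mem_coneIdeal.2 fun v hv => ?_
  by_cases hv0 : v = 0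
  · obtain ⟨p, hp⟩ := hX
    have := hf.eval_smul 0 p.coords
    rwa [h p hp, mul_zero, zero_smul, ← hv0] at this
  · exact (eval_coords_mk_eq_zero_iff hf v hv0).1 (h _ (hv hv0))

theorem coneIdeal_anti {X Y : Set (ProjSpace N)} (h : X ⊆ Y) : coneIdeal Y ≤ coneIdeal X :=
  fun _ hf => mem_coneIdeal.2 fun v hv => mem_coneIdeal.1 hf v (cone_mono h hv)

theorem subset_of_coneIdeal_le {X Y : Set (ProjSpace N)} (hX : IsClosed X)
    (h : coneIdeal X ≤ coneIdeal Y) : Y ⊆ X :=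
  subset_of_cone_subset fun v hv => (mem_cone_iff_forall_eval hX).2 fun _ hf =>
    mem_coneIdeal.1 (h (mem_coneIdeal.2 hf)) v hv

attribute [local instance] MvPolynomial.gradedAlgebra in
-- The ideal is graded, so primality needs testing only on forms; there it is irreducibility of `X`
-- against the two closed sets where the factors vanish.
theorem isPrime_coneIdeal {X : Set (ProjSpace N)} (hX : IsIrreducible X) :
    (coneIdeal X).IsPrime := by
  have hh : (coneIdeal X).IsHomogeneous (homogeneousSubmodule (Fin (N + 1)) ℂ) := fun i f hf => by
    have := homogeneousComponent_mem_coneIdeal hf i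
    rwa [← decomposition.decompose'_apply] at this
  refine hh.isPrime_of_homogeneous_mem_or_mem ?_ ?_
  · rw [Ideal.ne_top_iff_one, mem_coneIdeal]
    intro h
    simpa using h 0 (zero_mem_cone X)
  · rintro f g ⟨m, hm⟩ ⟨n, hn⟩ hfg
    have hm' : f.IsHomogeneous m := hm
    have hn' : g.IsHomogeneous n := hn
    have hcov : X ⊆ {p : ProjSpace N | eval p.coords f = 0} ∪
        {p : ProjSpace N | eval p.coords g = 0} := fun p hp => by
      have := mem_coneIdeal.1 hfg p.coords (coords_mem_cone.2 hp)
      rw [map_mul, mul_eq_zero] at this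
      exact this
    rcases isPreirreducible_iff_isClosed_union_isClosed.1 hX.isPreirreducible _ _
      (isClosed_setOf_eval_eq_zero hm') (isClosed_setOf_eval_eq_zero hn') hcov with h | h
    · exact Or.inl (mem_coneIdeal_of_isHomogeneous hX.nonempty hm' h)
    · exact Or.inr (mem_coneIdeal_of_isHomogeneous hX.nonempty hn' h)

theorem mk_eq_mk_of_mul_eq {v w : Fin (N + 1) → ℂ} (hv : v ≠ 0) (hw : w ≠ 0)
    (h : ∀ i j, v i * w j = v j * w i) : mk v hv = mk w hw := by
  obtain ⟨i, hi⟩ : ∃ i, w i ≠ 0 := Function.ne_iff.1 hw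
  refine (mk_eq_mk_iff hv hw).2 ⟨v i / w i, funext fun j => ?_⟩
  rw [Pi.smul_apply, smul_eq_mul, div_mul_eq_mul_div, h i j, mul_div_cancel_right₀ _ hi]

/-- A point is cut out by the `2 × 2` minors against its coordinate vector. Closed points serve as
bottom terms of chains. -/
instance : T1Space (ProjSpace N) := by
  refine ⟨fun p => ?_⟩
  have : {p} = ⋂ i, ⋂ j, {q : ProjSpace N |
      eval q.coords (C (p.coords j) * X i - C (p.coords i) * X j) = 0} := by
    ext q
    simp only [Set.mem_singleton_iff, Set.mem_iInter, Set.mem_ofPred_eq, map_sub, map_mul, eval_C,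
      eval_X]
    refine ⟨fun h i j => by rw [h]; ring, fun h => ?_⟩
    rw [← q.mk_coords, ← p.mk_coords]
    exact mk_eq_mk_of_mul_eq _ _ fun i j => by linear_combination h i j
  rw [this]
  exact isClosed_iInter fun i => isClosed_iInter fun j => isClosed_setOf_eval_eq_zero (n := 1)
    ((isHomogeneous_C_mul_X _ _).sub (isHomogeneous_C_mul_X _ _))

instance : TopologicalSpace.NoetherianSpace (ProjSpace N) := by
  refine (TopologicalSpace.noetherianSpace_TFAE (ProjSpace N)).out 0 1 |>.2 ?_
  let f : TopologicalSpace.Closeds (ProjSpace N) → (Ideal (MvPolynomial (Fin (N + 1)) ℂ))ᵒᵈ :=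
    fun Z => OrderDual.toDual (coneIdeal (Z : Set (ProjSpace N)))
  have hf : StrictMono f := fun A B hAB => by
    refine lt_of_le_not_ge (OrderDual.toDual_le_toDual.2 (coneIdeal_anti hAB.le)) fun h => ?_
    exact hAB.not_ge (subset_of_coneIdeal_le A.isClosed (OrderDual.toDual_le_toDual.1 h))
  exact hf.wellFoundedLT

end ProjSpace

/-! ### Continuity of regular maps, and chains in a product -/

namespace ProjSpace

variable {N M : ℕ}

/-- If the form `F` separates the image of `x` from `Z`, then the locus where `F ∘ G` and some `G j`
do not vanish is an open neighbourhood of `x` which avoids the preimage of `Z`. -/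
theorem IsRegular.continuous {X : Set (ProjSpace N)} {f : X → ProjSpace M} (hf : IsRegular X f) :
    Continuous f := by
  refine continuous_iff_isClosed.2 fun Z hZ => ?_
  rw [← isOpen_compl_iff]
  refine isOpen_iff_forall_mem_open.2 fun x hx => ?_
  obtain ⟨n, G, hG, hGx, hGf⟩ := hf x
  obtain ⟨m, F, hF, hFZ, hFx⟩ := exists_isHomogeneous_of_notMem hZ hx
  have hGF : (aeval G F).IsHomogeneous (n * m) := hF.aeval G hG
  have heval : ∀ v : Fin (N + 1) → ℂ, eval v (aeval G F) = eval (fun j => eval v (G j)) F :=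
    fun v => by
      rw [← aeval_eq_eval, ← AlgHom.comp_apply, comp_aeval]
      simp [aeval_eq_eval]
  obtain ⟨j, hj⟩ := Function.ne_iff.1 hGx
  refine ⟨(Subtype.val ⁻¹' {p | eval p.coords (aeval G F) = 0})ᶜ ∩
    (Subtype.val ⁻¹' {p | eval p.coords (G j) = 0})ᶜ, ?_, ?_, ?_⟩
  · rintro z ⟨hz1, hz2⟩ hz
    have hz0 : (fun j => eval z.1.coords (G j)) ≠ 0 := Function.ne_iff.2 ⟨j, hz2⟩
    refine hz1 ?_
    change eval z.1.coords (aeval G F) = 0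
    rw [heval, ← eval_coords_mk_eq_zero_iff hF _ hz0, ← hGf z hz0]
    exact hFZ _ (coords_mem_cone.2 hz)
  · exact (((isClosed_setOf_eval_eq_zero hGF).preimage continuous_subtype_val).isOpen_compl).inter
      (((isClosed_setOf_eval_eq_zero (hG j)).preimage continuous_subtype_val).isOpen_compl)
  · refine ⟨?_, hj⟩
    change eval x.1.coords (aeval G F) ≠ 0
    rwa [heval, Ne, ← eval_coords_mk_eq_zero_iff hF _ hGx, ← hGf x hGx]

/-- Substituting constants for the first set of variables. -/
noncomputable def substLeft {σ τ : Type*} (v : σ → ℂ) :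
    MvPolynomial (σ ⊕ τ) ℂ →ₐ[ℂ] MvPolynomial τ ℂ :=
  aeval (Sum.elim (fun i => C (v i)) X)

/-- Substituting constants for the second set of variables. -/
noncomputable def substRight {σ τ : Type*} (w : τ → ℂ) :
    MvPolynomial (σ ⊕ τ) ℂ →ₐ[ℂ] MvPolynomial σ ℂ :=
  aeval (Sum.elim X (fun i => C (w i)))

theorem eval_substLeft {σ τ : Type*} (v : σ → ℂ) (w : τ → ℂ) (F : MvPolynomial (σ ⊕ τ) ℂ) :
    eval w (substLeft v F) = eval (Sum.elim v w) F := by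
  rw [← aeval_eq_eval, ← aeval_eq_eval, substLeft, ← AlgHom.comp_apply, comp_aeval]
  congr 2
  ext (i | i) <;> simp

theorem eval_substRight {σ τ : Type*} (v : σ → ℂ) (w : τ → ℂ) (F : MvPolynomial (σ ⊕ τ) ℂ) :
    eval v (substRight w F) = eval (Sum.elim v w) F := by
  rw [← aeval_eq_eval, ← aeval_eq_eval, substRight, ← AlgHom.comp_apply, comp_aeval]
  congr 2
  ext (i | i) <;> simp

theorem IsBihomogeneous.sum_eq {F : MvPolynomial (Fin (N + 1) ⊕ Fin (N + 1)) ℂ} {a b : ℕ}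
    (hF : IsBihomogeneous F a b) {e : Fin (N + 1) ⊕ Fin (N + 1) →₀ ℕ} (he : e ∈ F.support) :
    ∑ i, e (Sum.inl i) = a ∧ ∑ i, e (Sum.inr i) = b := by
  have h := hF (mem_support_iff.1 he)
  rw [Finsupp.weight_apply, Finsupp.sum_fintype _ _ (by simp), Fintype.sum_sum_type] at h
  simpa [Prod.ext_iff, Prod.fst_sum, Prod.snd_sum] using h

theorem IsBihomogeneous.substLeft {F : MvPolynomial (Fin (N + 1) ⊕ Fin (N + 1)) ℂ} {a b : ℕ}
    (hF : IsBihomogeneous F a b) (v : Fin (N + 1) → ℂ) : (substLeft v F).IsHomogeneous b := by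
  rw [ProjSpace.substLeft, aeval_def, eval₂_eq']
  refine IsHomogeneous.sum _ _ _ fun e he => ?_
  rw [Fintype.prod_sum_type, ← (hF.sum_eq he).2, algebraMap_eq]
  refine IsHomogeneous.C_mul ?_ _
  rw [← zero_add (∑ i, e (Sum.inr i))]
  refine IsHomogeneous.mul ?_ (IsHomogeneous.prod _ _ _ fun i _ => isHomogeneous_X_pow _ _)
  simp only [Sum.elim_inl, ← map_pow, ← map_prod]
  exact isHomogeneous_C _ _

theorem IsBihomogeneous.substRight {F : MvPolynomial (Fin (N + 1) ⊕ Fin (N + 1)) ℂ} {a b : ℕ}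
    (hF : IsBihomogeneous F a b) (v : Fin (N + 1) → ℂ) : (substRight v F).IsHomogeneous a := by
  rw [ProjSpace.substRight, aeval_def, eval₂_eq']
  refine IsHomogeneous.sum _ _ _ fun e he => ?_
  rw [Fintype.prod_sum_type, ← (hF.sum_eq he).1, algebraMap_eq]
  refine IsHomogeneous.C_mul ?_ _
  rw [← add_zero (∑ i, e (Sum.inl i))]
  refine IsHomogeneous.mul (IsHomogeneous.prod _ _ _ fun i _ => isHomogeneous_X_pow _ _) ?_
  simp only [Sum.elim_inr, ← map_pow, ← map_prod]
  exact isHomogeneous_C _ _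

/-- Freezing one factor turns bihomogeneous formulas into homogeneous ones. Only continuity in each
variable separately is used later, so no Zariski topology on `X × Y` is needed. -/
theorem IsRegularOnProd.continuous_left {X Y : Set (ProjSpace N)} {f : X × Y → ProjSpace M}
    (hf : IsRegularOnProd X Y f) (y : Y) : Continuous fun x => f (x, y) := by
  refine IsRegular.continuous fun x => ?_
  obtain ⟨a, b, G, hG, hGx, hGf⟩ := hf (x, y)
  refine ⟨a, fun j => substRight y.1.coords (G j), fun j => (hG j).substRight _, ?_, ?_⟩
  · simpa only [eval_substRight] using hGx
  · intro z hz
    simp only [eval_substRight] at hz ⊢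
    exact hGf (z, y) hz

theorem IsRegularOnProd.continuous_right {X Y : Set (ProjSpace N)} {f : X × Y → ProjSpace M}
    (hf : IsRegularOnProd X Y f) (x : X) : Continuous fun y => f (x, y) := by
  refine IsRegular.continuous fun y => ?_
  obtain ⟨a, b, G, hG, hGx, hGf⟩ := hf (x, y)
  refine ⟨b, fun j => substLeft x.1.coords (G j), fun j => (hG j).substLeft _, ?_, ?_⟩
  · simpa only [eval_substLeft] using hGx
  · intro z hz
    simp only [eval_substLeft] at hz ⊢
    exact hGf (x, z) hz

open TopologicalSpace

theorem _root_.IsIrreducible.preimage_val {α : Type*} [TopologicalSpace α] {X A : Set α}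
    (hA : IsIrreducible A) (h : A ⊆ X) : IsIrreducible (Subtype.val ⁻¹' A : Set X) := by
  refine ⟨?_, ?_⟩
  · obtain ⟨a, ha⟩ := hA.nonempty
    exact ⟨⟨a, h ha⟩, ha⟩
  · rintro _ _ ⟨U, hU, rfl⟩ ⟨V, hV, rfl⟩ ⟨x, hx, hxU⟩ ⟨y, hy, hyV⟩
    obtain ⟨z, hz, hzUV⟩ := hA.isPreirreducible U V hU hV ⟨x, hx, hxU⟩ ⟨y, hy, hyV⟩
    exact ⟨⟨z, h hz⟩, hz, hzUV⟩

/-- The length of a chain of irreducible closed subsets of `X` is at most the dimension. -/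
theorem length_le_dim {X : Set (ProjSpace N)} (p : LTSeries (IrreducibleCloseds (ProjSpace N)))
    (h : (p.last : Set (ProjSpace N)) ⊆ X) : (p.length : WithBot ℕ∞) ≤ dim X := by
  have hsub : ∀ i, (p i : Set (ProjSpace N)) ⊆ X := fun i =>
    (SetLike.coe_subset_coe.2 (p.monotone (Fin.le_last i))).trans h
  let q : LTSeries (IrreducibleCloseds X) := LTSeries.mk p.length
    (fun i => ⟨Subtype.val ⁻¹' (p i : Set (ProjSpace N)),
      (p i).isIrreducible.preimage_val (hsub i), (p i).isClosed.preimage continuous_subtype_val⟩)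
    (by
      intro i j hij
      have hp := p.strictMono hij
      refine lt_of_le_not_ge (fun x hx => hp.le hx) fun hji => hp.not_ge fun x hx => ?_
      exact hji (show (⟨x, hsub j hx⟩ : X) ∈ _ from hx))
  exact Order.LTSeries.length_le_krullDim q

/-- Each slice `f a '' B` lies in `Z₁` or in `Z₂`; the two sets of such `a` are closed and cover
`A`, so one of them contains `A`. -/
theorem _root_.IsIrreducible.image2 {α β γ : Type*} [TopologicalSpace α] [TopologicalSpace β]
    [TopologicalSpace γ] {f : α → β → γ} (h₁ : ∀ b, Continuous fun a => f a b)
    (h₂ : ∀ a, Continuous (f a)) {A : Set α} {B : Set β} (hA : IsIrreducible A)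
    (hB : IsIrreducible B) : IsIrreducible (Set.image2 f A B) := by
  refine ⟨hA.nonempty.image2 hB.nonempty, ?_⟩
  rw [isPreirreducible_iff_isClosed_union_isClosed]
  intro Z₁ Z₂ hZ₁ hZ₂ hcov
  have hclosed : ∀ Z : Set γ, IsClosed Z → IsClosed {a | ∀ b ∈ B, f a b ∈ Z} := fun Z hZ => by
    simp only [Set.ofPred_forall]
    exact isClosed_biInter fun b _ => hZ.preimage (h₁ b)
  have key : A ⊆ {a | ∀ b ∈ B, f a b ∈ Z₁} ∪ {a | ∀ b ∈ B, f a b ∈ Z₂} := fun a ha =>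
    isPreirreducible_iff_isClosed_union_isClosed.1 hB.isPreirreducible _ _
      (hZ₁.preimage (h₂ a)) (hZ₂.preimage (h₂ a)) fun b hb => hcov (Set.mem_image2_of_mem ha hb)
  rcases isPreirreducible_iff_isClosed_union_isClosed.1 hA.isPreirreducible _ _
    (hclosed _ hZ₁) (hclosed _ hZ₂) key with h | h
  · exact Or.inl (Set.image2_subset_iff.2 h)
  · exact Or.inr (Set.image2_subset_iff.2 h)

/-- Climb the first factor over the bottom of the second, then the second over the top of the first.
-/
theorem _root_.LTSeries.exists_prod {α β : Type*} [PartialOrder α] [PartialOrder β]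
    (p : LTSeries α) (q : LTSeries β) : ∃ r : LTSeries (α × β),
      r.length = p.length + q.length ∧ r.last = (p.last, q.last) := by
  have h₁ : StrictMono fun a : α => (a, q.head) := fun a b h => by simpa using h
  have h₂ : StrictMono fun b : β => (p.last, b) := fun a b h => by simpa using h
  refine ⟨RelSeries.smash (p.map _ h₁) (q.map _ h₂) ?_, rfl, ?_⟩
  · rw [LTSeries.last_map, LTSeries.head_map]
  · rw [RelSeries.last_smash, LTSeries.last_map]

section ProductChains

variable {X Y W : Set (ProjSpace N)} (hW : IsClosed W) (e : X × Y ≃ W)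
  (h₁ : ∀ y, Continuous fun x => (e (x, y) : ProjSpace N))
  (h₂ : ∀ x, Continuous fun y => (e (x, y) : ProjSpace N))
  (h₃ : Continuous fun w => ((e.symm w).1 : ProjSpace N))
  (h₄ : Continuous fun w => ((e.symm w).2 : ProjSpace N))

/-- The image of `A × B` under a separately continuous bijection with continuous inverse. -/
def prodImage (A : IrreducibleCloseds X) (B : IrreducibleCloseds Y) :
    IrreducibleCloseds (ProjSpace N) where
  carrier := Set.image2 (fun x y => (e (x, y) : ProjSpace N)) A B
  isIrreducible' := IsIrreducible.image2 h₁ h₂ A.isIrreducible B.isIrreducible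
  isClosed' := by
    have h : Set.image2 (fun x y => (e (x, y) : ProjSpace N)) A B =
        Subtype.val '' ((fun w => (e.symm w).1) ⁻¹' (A : Set X) ∩
          (fun w => (e.symm w).2) ⁻¹' (B : Set Y)) := by
      ext w
      constructor
      · rintro ⟨x, hx, y, hy, rfl⟩
        exact ⟨e (x, y), by simpa using ⟨hx, hy⟩, rfl⟩
      · rintro ⟨w, ⟨hx, hy⟩, rfl⟩
        exact ⟨_, hx, _, hy, by simp⟩
    rw [h]
    exact hW.isClosedEmbedding_subtypeVal.isClosedMap _
      ((A.isClosed.preimage (continuous_induced_rng.2 h₃)).inter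
        (B.isClosed.preimage (continuous_induced_rng.2 h₄)))

theorem mem_prodImage {A : IrreducibleCloseds X} {B : IrreducibleCloseds Y} {w : ProjSpace N} :
    w ∈ prodImage hW e h₁ h₂ h₃ h₄ A B ↔ ∃ x ∈ A, ∃ y ∈ B, (e (x, y) : ProjSpace N) = w :=
  Iff.rfl

theorem apply_mem_prodImage {A : IrreducibleCloseds X} {B : IrreducibleCloseds Y} {x : X} {y : Y} :
    (e (x, y) : ProjSpace N) ∈ prodImage hW e h₁ h₂ h₃ h₄ A B ↔ x ∈ A ∧ y ∈ B := by
  rw [mem_prodImage]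
  constructor
  · rintro ⟨x', hx, y', hy, h⟩
    obtain ⟨rfl, rfl⟩ := Prod.mk.inj (e.injective (Subtype.val_injective h))
    exact ⟨hx, hy⟩
  · rintro ⟨hx, hy⟩
    exact ⟨x, hx, y, hy, rfl⟩

theorem prodImage_strictMono :
    StrictMono fun z : IrreducibleCloseds X × IrreducibleCloseds Y =>
      prodImage hW e h₁ h₂ h₃ h₄ z.1 z.2 := by
  rintro ⟨A, B⟩ ⟨A', B'⟩ h
  refine lt_of_le_not_ge ?_ fun hle => h.not_ge ?_
  · rintro _ ⟨x, hx, y, hy, rfl⟩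
    exact ⟨x, h.le.1 hx, y, h.le.2 hy, rfl⟩
  · obtain ⟨x₀, hx₀⟩ := A'.isIrreducible.nonempty
    obtain ⟨y₀, hy₀⟩ := B'.isIrreducible.nonempty
    refine ⟨fun x hx => ?_, fun y hy => ?_⟩
    · exact ((apply_mem_prodImage hW e h₁ h₂ h₃ h₄).1
        (hle ((apply_mem_prodImage hW e h₁ h₂ h₃ h₄).2 ⟨hx, hy₀⟩))).1
    · exact ((apply_mem_prodImage hW e h₁ h₂ h₃ h₄).1
        (hle ((apply_mem_prodImage hW e h₁ h₂ h₃ h₄).2 ⟨hx₀, hy⟩))).2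

/-- Chains in the factors combine to a chain in the image of the product. -/
theorem exists_ltSeries_prodImage (p : LTSeries (IrreducibleCloseds X))
    (q : LTSeries (IrreducibleCloseds Y)) :
    ∃ r : LTSeries (IrreducibleCloseds (ProjSpace N)), r.length = p.length + q.length ∧
      r.last = prodImage hW e h₁ h₂ h₃ h₄ p.last q.last := by
  obtain ⟨r, hr, hr'⟩ := p.exists_prod q
  refine ⟨r.map _ (prodImage_strictMono hW e h₁ h₂ h₃ h₄), hr, ?_⟩
  rw [LTSeries.last_map, hr']

end ProductChains

end ProjSpace

/-! ### Linear forms without common zeros and graded finiteness -/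

section Graded

variable {σ : Type*} {B : Type*} [CommRing B] [Algebra ℂ B]

/-- If the only common zero of the ideal `c` is the origin then `c` contains all forms of large
degree. -/
theorem MvPolynomial.exists_forall_isHomogeneous_mem [Finite σ] (c : Ideal (MvPolynomial σ ℂ))
    (h : ∀ v : σ → ℂ, (∀ f ∈ c, eval v f = 0) → v = 0) :
    ∃ s, ∀ k ≥ s, ∀ f : MvPolynomial σ ℂ, f.IsHomogeneous k → f ∈ c := by
  -- By the Nullstellensatz every variable lies in the radical of `c`.
  have hle : Ideal.span (Set.range (X : σ → MvPolynomial σ ℂ)) ≤ c.radical := by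
    rw [← vanishingIdeal_zeroLocus_eq_radical (K := ℂ), Ideal.span_le]
    rintro _ ⟨i, rfl⟩ v hv
    rw [h v fun f hf => by simpa [aeval_eq_eval] using hv f hf]
    simp
  obtain ⟨s, hs⟩ := Ideal.exists_pow_le_of_le_radical_of_fg hle
    (Submodule.fg_span (Set.finite_range _))
  refine ⟨s, fun k hk f hf => hs (Ideal.pow_le_pow_right hk ?_)⟩
  refine (Ideal.mem_span_pow_iff_exists_isHomogeneous _ _).2 ⟨map C f, hf.map C, ?_⟩
  rw [eval_map, eval₂_eta]

/-- The image of the linear forms under an algebra map out of a polynomial ring. -/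
noncomputable def linearPart (φ : MvPolynomial σ ℂ →ₐ[ℂ] B) : Submodule ℂ B :=
  (homogeneousSubmodule σ ℂ 1).map φ.toLinearMap

theorem linearPart_pow (φ : MvPolynomial σ ℂ →ₐ[ℂ] B) (k : ℕ) :
    linearPart φ ^ k = (homogeneousSubmodule σ ℂ k).map φ.toLinearMap := by
  rw [linearPart, ← Submodule.map_pow, homogeneousSubmodule_one_pow]

theorem mem_linearPart_pow {φ : MvPolynomial σ ℂ →ₐ[ℂ] B} {k : ℕ} {b : B} :
    b ∈ linearPart φ ^ k ↔ ∃ f : MvPolynomial σ ℂ, f.IsHomogeneous k ∧ φ f = b := by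
  rw [linearPart_pow]; rfl

theorem linearPart_eq_span (φ : MvPolynomial σ ℂ →ₐ[ℂ] B) :
    linearPart φ = Submodule.span ℂ (Set.range fun i => φ (X i)) := by
  rw [linearPart, homogeneousSubmodule_one_eq_span_X, Submodule.map_span, ← Set.range_comp]
  rfl

theorem linearPart_pow_fg [Finite σ] (φ : MvPolynomial σ ℂ →ₐ[ℂ] B) (k : ℕ) : (linearPart φ ^ k).FG := by
  rw [linearPart_pow]
  exact (homogeneousSubmodule_fg σ ℂ k).map _

instance [Finite σ] (φ : MvPolynomial σ ℂ →ₐ[ℂ] B) (k : ℕ) : FiniteDimensional ℂ ↥(linearPart φ ^ k) :=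
  Module.Finite.iff_fg.2 (linearPart_pow_fg φ k)

theorem homogeneousComponent_mem_mul_of_mem_span {F : Submodule ℂ (MvPolynomial σ ℂ)}
    (hF : F ≤ homogeneousSubmodule σ ℂ 1) {h : MvPolynomial σ ℂ}
    (hh : h ∈ Ideal.span (F : Set (MvPolynomial σ ℂ))) (r : ℕ) :
    homogeneousComponent (r + 1) h ∈ F * homogeneousSubmodule σ ℂ r := by
  -- The multiplier `a` carries the induction through polynomial coefficients of arbitrary degree.
  suffices ∀ a, homogeneousComponent (r + 1) (a * h) ∈ F * homogeneousSubmodule σ ℂ r by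
    simpa using this 1
  induction hh using Submodule.span_induction with
  | mem x hx =>
    intro a
    rw [mul_comm a, add_comm, homogeneousComponent_mul_of_isHomogeneous (hF hx)]
    exact Submodule.mul_mem_mul hx (homogeneousComponent_isHomogeneous r a)
  | zero => simp
  | add x y _ _ hx hy =>
    intro a
    rw [mul_add, map_add]
    exact add_mem (hx a) (hy a)
  | smul b x _ hx =>
    intro a
    rw [smul_eq_mul, ← mul_assoc]
    exact hx _

/-- If the linear forms in `F` have no common zero other than the origin on the zero set of
`ker φ`, then they generate everything in large degree. -/
theorem exists_linearPart_pow_succ_le [Finite σ] (φ : MvPolynomial σ ℂ →ₐ[ℂ] B)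
    (hφ : ∀ f, φ f = 0 → ∀ k, φ (homogeneousComponent k f) = 0)
    {F : Submodule ℂ (MvPolynomial σ ℂ)} (hF : F ≤ homogeneousSubmodule σ ℂ 1)
    (h : ∀ v : σ → ℂ, (∀ f, φ f = 0 → eval v f = 0) → (∀ f ∈ F, eval v f = 0) → v = 0) :
    ∃ r, ∀ k ≥ r, linearPart φ ^ (k + 1) ≤ F.map φ.toLinearMap * linearPart φ ^ k := by
  obtain ⟨s, hs⟩ := exists_forall_isHomogeneous_mem
    (RingHom.ker φ ⊔ Ideal.span (F : Set (MvPolynomial σ ℂ))) fun v hv =>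
      h v (fun f hf => hv f (Ideal.mem_sup_left hf))
        fun f hf => hv f (Ideal.mem_sup_right (Ideal.subset_span hf))
  refine ⟨s, fun k hk b hb => ?_⟩
  obtain ⟨f, hf, rfl⟩ := mem_linearPart_pow.1 hb
  obtain ⟨g, hg, u, hu, rfl⟩ := Submodule.mem_sup.1 (hs (k + 1) (by lia) f hf)
  -- The kernel is graded, so `g` contributes nothing in degree `k + 1`.
  have h1 : φ (g + u) = φ (homogeneousComponent (k + 1) u) := by
    rw [← homogeneousComponent_eq_self hf, map_add, map_add, hφ g hg, zero_add]
  rw [h1, linearPart_pow, ← Submodule.map_mul]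
  exact Submodule.mem_map_of_mem (homogeneousComponent_mem_mul_of_mem_span hF hu k)

/-- Incomparability: in an integral extension, strict inclusions of primes stay strict after
contraction. -/
theorem ringKrullDim_le_of_isIntegral {P B : Type*} [CommRing P] [CommRing B] [Algebra P B]
    [Algebra.IsIntegral P B] : ringKrullDim B ≤ ringKrullDim P := by
  refine Order.krullDim_le_of_strictMono (PrimeSpectrum.comap (algebraMap P B)) fun I J hIJ => ?_
  have := I.isPrime
  exact Ideal.IsIntegral.comap_lt_comap hIJ

/-- If `B` is generated in large degree by the linear forms `ℓ i` then its dimension is at most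
the number of these forms. -/
theorem ringKrullDim_le_of_linearPart_pow_succ_le [Finite σ] (φ : MvPolynomial σ ℂ →ₐ[ℂ] B)
    (hφ : Function.Surjective φ) {ι : Type*} [Finite ι] (ℓ : ι → B) {r : ℕ}
    (h : ∀ k ≥ r, linearPart φ ^ (k + 1) ≤
      Submodule.span ℂ (Set.range ℓ) * linearPart φ ^ k) :
    ringKrullDim B ≤ Nat.card ι := by
  let ψ : MvPolynomial ι ℂ →ₐ[ℂ] B := aeval ℓ
  let : Algebra (MvPolynomial ι ℂ) B := ψ.toRingHom.toAlgebra
  have hsmul : ∀ (p : MvPolynomial ι ℂ) (b : B), p • b = ψ p * b := fun p b => Algebra.smul_def p b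
  have : IsScalarTower ℂ (MvPolynomial ι ℂ) B :=
    IsScalarTower.of_algebraMap_eq fun x => (ψ.commutes x).symm
  -- The pieces of degree at most `r` generate `B` as a module over the polynomial ring in the `ℓ
  -- i`, since each higher degree is reached by multiplying with some `ℓ i`. So `B` is finite over
  -- that ring.
  let G : Submodule ℂ B := ⨆ k ∈ Finset.range (r + 1), linearPart φ ^ k
  have hG : G.FG := Submodule.fg_biSup _ _ fun k _ => linearPart_pow_fg φ k
  let S : Submodule (MvPolynomial ι ℂ) B := Submodule.span _ (G : Set B)
  have hGS : G ≤ S.restrictScalars ℂ := Submodule.subset_span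
  have hle : ∀ k, linearPart φ ^ k ≤ S.restrictScalars ℂ := by
    intro k
    induction k with
    | zero => exact (le_biSup (fun k => linearPart φ ^ k) (Finset.mem_range.2 r.succ_pos)).trans hGS
    | succ k ih =>
      by_cases hk : k < r
      · exact (le_biSup (fun k => linearPart φ ^ k) (Finset.mem_range.2 (by lia))).trans hGS
      · refine (h k (not_lt.1 hk)).trans (Submodule.mul_le.2 fun x hx y hy => ?_)
        have hx' : x ∈ LinearMap.range ψ.toLinearMap := by
          refine Submodule.span_le.2 ?_ hx
          rintro _ ⟨i, rfl⟩
          exact ⟨X i, by simp [ψ]⟩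
        obtain ⟨p, rfl⟩ := hx'
        have := S.smul_mem p (ih hy)
        rwa [hsmul] at this
  have hS : S = ⊤ := by
    refine eq_top_iff.2 fun b _ => ?_
    obtain ⟨f, rfl⟩ := hφ b
    rw [← sum_homogeneousComponent f, map_sum]
    exact sum_mem fun k _ => hle k
      (mem_linearPart_pow.2 ⟨_, homogeneousComponent_isHomogeneous k f, rfl⟩)
  have : Module.Finite (MvPolynomial ι ℂ) B := by
    obtain ⟨t, ht⟩ := hG
    refine ⟨⟨t, ?_⟩⟩
    rw [← hS, ← Submodule.span_span_of_tower ℂ (MvPolynomial ι ℂ), ht]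
  have := ringKrullDim_le_of_isIntegral (P := MvPolynomial ι ℂ) (B := B)
  rwa [MvPolynomial.ringKrullDim_of_isNoetherianRing, ringKrullDim_eq_zero_of_field,
    zero_add] at this

end Graded

/-! ### Dimension bound for disjoint closed sets, by reduction to the diagonal -/

namespace ProjSpace

variable {N : ℕ}

open TopologicalSpace

/-- The subset `A × B` of the affine space with the coordinates of both factors. -/
def sumProd {σ τ : Type} (A : Set (σ → ℂ)) (B : Set (τ → ℂ)) : Set (σ ⊕ τ → ℂ) :=
  {v | v ∘ Sum.inl ∈ A ∧ v ∘ Sum.inr ∈ B}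

theorem elim_mem_sumProd {σ τ : Type} {A : Set (σ → ℂ)} {B : Set (τ → ℂ)} {a : σ → ℂ}
    {b : τ → ℂ} : Sum.elim a b ∈ sumProd A B ↔ a ∈ A ∧ b ∈ B := by
  simp [sumProd]

theorem mem_vanishingIdeal_sumProd {σ τ : Type} {A : Set (σ → ℂ)} {B : Set (τ → ℂ)}
    {f : MvPolynomial (σ ⊕ τ) ℂ} :
    f ∈ vanishingIdeal ℂ (sumProd A B) ↔ ∀ a ∈ A, ∀ b ∈ B, eval (Sum.elim a b) f = 0 := by
  simp only [mem_vanishingIdeal_iff, aeval_eq_eval]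
  refine ⟨fun h a ha b hb => h _ (elim_mem_sumProd.2 ⟨ha, hb⟩), fun h v hv => ?_⟩
  rw [← Sum.elim_comp_inl_inr v]
  exact h _ hv.1 _ hv.2

/-- Over an algebraically closed field, products of irreducible sets are irreducible. -/
theorem isPrime_vanishingIdeal_sumProd {σ τ : Type} {A : Set (σ → ℂ)} {B : Set (τ → ℂ)}
    (hA : (vanishingIdeal ℂ A).IsPrime) (hB : (vanishingIdeal ℂ B).IsPrime) :
    (vanishingIdeal ℂ (sumProd A B)).IsPrime := by
  have hne : ∀ {ι : Type} {C : Set (ι → ℂ)}, (vanishingIdeal ℂ C).IsPrime → C.Nonempty :=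
    fun {ι C} hC => by
      rw [Set.nonempty_iff_ne_empty]
      rintro rfl
      exact hC.ne_top vanishingIdeal_empty
  have hmem : ∀ {ι : Type} {C : Set (ι → ℂ)} {f : MvPolynomial ι ℂ},
      f ∉ vanishingIdeal ℂ C ↔ ∃ c ∈ C, eval c f ≠ 0 := by
    intro ι C f
    simp [aeval_eq_eval]
  refine ⟨?_, fun {f g} hfg => ?_⟩
  · obtain ⟨a, ha⟩ := hne hA
    obtain ⟨b, hb⟩ := hne hB
    rw [Ideal.ne_top_iff_one, mem_vanishingIdeal_sumProd]
    intro h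
    simpa using h a ha b hb
  · by_contra! hcon
    rw [mem_vanishingIdeal_sumProd, mem_vanishingIdeal_sumProd] at hcon
    push Not at hcon
    obtain ⟨⟨a₀, ha₀, b₀, hb₀, hf⟩, a₁, ha₁, b₁, hb₁, hg⟩ := hcon
    rw [← eval_substLeft] at hf hg
    -- The points `a₀`, `a₁` may differ. Primality over `B` first gives one `b` good for both
    -- factors; primality over `A` then gives one `a`.
    have h1 : substLeft a₀ f * substLeft a₁ g ∉ vanishingIdeal ℂ B := fun h =>
      (hB.mem_or_mem h).elim (hmem.2 ⟨b₀, hb₀, hf⟩) (hmem.2 ⟨b₁, hb₁, hg⟩)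
    obtain ⟨b, hb, hfgb⟩ := hmem.1 h1
    rw [map_mul, eval_substLeft, eval_substLeft, ← eval_substRight, ← eval_substRight] at hfgb
    have h2 : substRight b f * substRight b g ∉ vanishingIdeal ℂ A := fun h =>
      (hA.mem_or_mem h).elim (hmem.2 ⟨a₀, ha₀, left_ne_zero_of_mul hfgb⟩)
        (hmem.2 ⟨a₁, ha₁, right_ne_zero_of_mul hfgb⟩)
    obtain ⟨a, ha, hfga⟩ := hmem.1 h2
    rw [← map_mul, eval_substRight] at hfga
    exact hfga (mem_vanishingIdeal_sumProd.1 hfg a ha b hb)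

/-- The prime ideal of the product of the zero sets of two prime ideals. -/
noncomputable def primeProd {σ τ : Type} [Finite σ] [Finite τ]
    (p : PrimeSpectrum (MvPolynomial σ ℂ)) (q : PrimeSpectrum (MvPolynomial τ ℂ)) :
    PrimeSpectrum (MvPolynomial (σ ⊕ τ) ℂ) where
  asIdeal := vanishingIdeal ℂ (sumProd (MvPolynomial.zeroLocus ℂ p.asIdeal)
    (MvPolynomial.zeroLocus ℂ q.asIdeal))
  isPrime := by
    have := p.isPrime
    have := q.isPrime
    refine isPrime_vanishingIdeal_sumProd ?_ ?_ <;>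
      rwa [IsPrime.vanishingIdeal_zeroLocus]

/-- Each factor can be read off from the product: test polynomials in one set of variables, with a
point of the other factor fixed. -/
theorem primeProd_strictMono {σ τ : Type} [Finite σ] [Finite τ] :
    StrictMono fun z : PrimeSpectrum (MvPolynomial σ ℂ) × PrimeSpectrum (MvPolynomial τ ℂ) =>
      primeProd z.1 z.2 := by
  have key : ∀ {ι : Type} [Finite ι] (p : PrimeSpectrum (MvPolynomial ι ℂ))
      (f : MvPolynomial ι ℂ), f ∈ p.asIdeal ↔
        ∀ v ∈ MvPolynomial.zeroLocus ℂ p.asIdeal, eval v f = 0 := fun {ι} _ p f => by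
    have := p.isPrime
    conv_lhs => rw [← IsPrime.vanishingIdeal_zeroLocus (K := ℂ) p.asIdeal]
    simp only [mem_vanishingIdeal_iff, aeval_eq_eval]
  have hne : ∀ {ι : Type} [Finite ι] (p : PrimeSpectrum (MvPolynomial ι ℂ)),
      ∃ v, v ∈ MvPolynomial.zeroLocus ℂ p.asIdeal := fun {ι} _ p => by
    by_contra! h
    exact p.isPrime.ne_top ((Ideal.eq_top_iff_one _).2 ((key p 1).2 fun v hv => absurd hv (h v)))
  rintro ⟨p, q⟩ ⟨p', q'⟩ h
  refine lt_of_le_not_ge ?_ fun hle => h.not_ge ?_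
  · refine vanishingIdeal_anti_mono fun v hv => ?_
    exact ⟨zeroLocus_anti_mono h.le.1 hv.1, zeroLocus_anti_mono h.le.2 hv.2⟩
  · obtain ⟨a, ha⟩ := hne p
    obtain ⟨b, hb⟩ := hne q
    refine ⟨fun f hf => (key p f).2 fun v hv => ?_, fun f hf => (key q f).2 fun v hv => ?_⟩
    · have : rename Sum.inl f ∈ (primeProd p' q').asIdeal :=
        mem_vanishingIdeal_sumProd.2 fun v hv w _ => by
          rw [eval_rename, Sum.elim_comp_inl]
          exact (key p' f).1 hf v hv
      have := mem_vanishingIdeal_sumProd.1 (hle this) v hv b hb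
      rwa [eval_rename, Sum.elim_comp_inl] at this
    · have : rename Sum.inr f ∈ (primeProd p' q').asIdeal :=
        mem_vanishingIdeal_sumProd.2 fun v _ w hw => by
          rw [eval_rename, Sum.elim_comp_inr]
          exact (key q' f).1 hf w hw
      have := mem_vanishingIdeal_sumProd.1 (hle this) a ha v hv
      rwa [eval_rename, Sum.elim_comp_inr] at this

/-- A chain of primes containing `I` bounds the dimension of the quotient by `I` from below. -/
theorem length_le_ringKrullDim_quotient {R : Type*} [CommRing R] {I : Ideal R}
    (r : LTSeries (PrimeSpectrum R)ᵒᵈ) (h : I ≤ (OrderDual.ofDual r.last).asIdeal) :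
    (r.length : WithBot ℕ∞) ≤ ringKrullDim (R ⧸ I) := by
  rw [ringKrullDim_quotient, ← Order.krullDim_orderDual]
  let s : LTSeries (PrimeSpectrum.zeroLocus (I : Set R))ᵒᵈ := LTSeries.mk r.length
    (fun i => OrderDual.toDual ⟨OrderDual.ofDual (r i),
      h.trans (OrderDual.ofDual_le_ofDual.2 (r.monotone (Fin.le_last i)))⟩)
    fun i j hij => r.strictMono hij
  exact Order.LTSeries.length_le_krullDim s

/-- The prime ideal of the cone over an irreducible closed set. -/
noncomputable def conePrime (A : IrreducibleCloseds (ProjSpace N)) :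
    PrimeSpectrum (MvPolynomial (Fin (N + 1)) ℂ) :=
  ⟨coneIdeal (A : Set (ProjSpace N)), isPrime_coneIdeal A.isIrreducible⟩

theorem conePrime_strictMono :
    StrictMono fun A : IrreducibleCloseds (ProjSpace N) => OrderDual.toDual (conePrime A) := by
  intro A B hAB
  refine lt_of_le_not_ge (OrderDual.toDual_le_toDual.2 (coneIdeal_anti hAB.le)) fun h => ?_
  exact hAB.not_ge (subset_of_coneIdeal_le A.isClosed (OrderDual.toDual_le_toDual.1 h))

/-- A chain of irreducible closed sets, followed by the origin, gives a chain of primes. -/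
theorem exists_ltSeries_conePrime (p : LTSeries (IrreducibleCloseds (ProjSpace N))) :
    ∃ r : LTSeries (PrimeSpectrum (MvPolynomial (Fin (N + 1)) ℂ))ᵒᵈ,
      r.length = p.length + 1 ∧ r.last = OrderDual.toDual (conePrime p.last) := by
  let o : PrimeSpectrum (MvPolynomial (Fin (N + 1)) ℂ) := pointToPoint (0 : Fin (N + 1) → ℂ)
  have ho : OrderDual.toDual o < OrderDual.toDual (conePrime p.head) := by
    refine OrderDual.toDual_lt_toDual.2 (lt_of_le_not_ge ?_ fun h => ?_)
    · exact vanishingIdeal_anti_mono (Set.singleton_subset_iff.2 (zero_mem_cone _))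
    · obtain ⟨x, hx⟩ := p.head.isIrreducible.nonempty
      refine x.coords_ne_zero (funext fun i => ?_)
      have h0 : (X i : MvPolynomial (Fin (N + 1)) ℂ) ∈ o.asIdeal := by
        simp [o, pointToPoint]
      simpa using mem_coneIdeal.1 (h h0) x.coords (coords_mem_cone.2 hx)
  refine ⟨(p.map _ conePrime_strictMono).cons (OrderDual.toDual o) (by
    rw [LTSeries.head_map]; exact ho), by simp, ?_⟩
  rw [RelSeries.last_cons, LTSeries.last_map]

theorem zeroLocus_conePrime (A : IrreducibleCloseds (ProjSpace N)) :
    MvPolynomial.zeroLocus ℂ (conePrime A).asIdeal = cone (A : Set (ProjSpace N)) := by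
  ext v
  rw [mem_cone_iff_forall_eval A.isClosed, MvPolynomial.mem_zeroLocus_iff]
  simp [aeval_eq_eval, conePrime, mem_coneIdeal]

/-- Disjoint irreducible closed subsets of a projective space have small dimension. -/
theorem length_add_length_le_of_disjoint {p q : LTSeries (IrreducibleCloseds (ProjSpace N))}
    (hpq : Disjoint (p.last : Set (ProjSpace N)) q.last) (J : Finset (Fin (N + 1)))
    (hp : ∀ x ∈ p.last, ∀ i ∉ J, coords x i = 0) (hq : ∀ x ∈ q.last, ∀ i ∉ J, coords x i = 0) :
    p.length + q.length + 2 ≤ J.card := by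
  obtain ⟨P, hP, hP'⟩ := exists_ltSeries_conePrime p
  obtain ⟨Q, hQ, hQ'⟩ := exists_ltSeries_conePrime q
  obtain ⟨r, hr, hr'⟩ := P.exists_prod Q
  have hmono : StrictMono fun z : (PrimeSpectrum (MvPolynomial (Fin (N + 1)) ℂ))ᵒᵈ ×
      (PrimeSpectrum (MvPolynomial (Fin (N + 1)) ℂ))ᵒᵈ => OrderDual.toDual
        (primeProd (OrderDual.ofDual z.1) (OrderDual.ofDual z.2)) := fun a b hab =>
    OrderDual.toDual_lt_toDual.2 (primeProd_strictMono (a := (b.1.ofDual, b.2.ofDual))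
      (b := (a.1.ofDual, a.2.ofDual)) hab)
  let I := (primeProd (conePrime p.last) (conePrime q.last)).asIdeal
  have hI : ∀ f, f ∈ I ↔ ∀ a ∈ cone (p.last : Set (ProjSpace N)),
      ∀ b ∈ cone (q.last : Set (ProjSpace N)), eval (Sum.elim a b) f = 0 := fun f => by
    change f ∈ vanishingIdeal ℂ _ ↔ _
    rw [mem_vanishingIdeal_sumProd, zeroLocus_conePrime, zeroLocus_conePrime]
  -- The summand `2` comes from the two origins: each affine cone has one dimension more than its
  -- projective set.
  have hlow : ((p.length + q.length + 2 : ℕ) : WithBot ℕ∞) ≤ ringKrullDim (_ ⧸ I) := by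
    have := length_le_ringKrullDim_quotient (I := I) (r.map _ hmono) (by
      rw [LTSeries.last_map, hr', hP', hQ']; exact le_rfl)
    rwa [show (r.map _ hmono).length = p.length + q.length + 2 by
      change r.length = _; lia] at this
  let φ := Ideal.Quotient.mkₐ ℂ I
  have hφ : ∀ f, φ f = 0 ↔ f ∈ I := fun f => Ideal.Quotient.eq_zero_iff_mem
  -- The diagonal equations are needed only for indices in `J`, since the other coordinates vanish
  -- on both sets. On the product of the cones they leave pairs `(v, v)`, and disjointness forces `v
  -- = 0`.
  let δ : J → MvPolynomial (Fin (N + 1) ⊕ Fin (N + 1)) ℂ :=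
    fun i => X (Sum.inl i.1) - X (Sum.inr i.1)
  obtain ⟨r', hr'⟩ := exists_linearPart_pow_succ_le φ (fun f hf k => by
      rw [hφ, hI] at hf ⊢
      refine fun a ha b hb => eval_homogeneousComponent_eq_zero (fun t => ?_) k
      rw [show t • Sum.elim a b = Sum.elim (t • a) (t • b) by ext (i | i) <;> rfl]
      exact hf _ (smul_mem_cone ha t) _ (smul_mem_cone hb t))
    (F := Submodule.span ℂ (Set.range δ)) (by
      rw [Submodule.span_le]
      rintro _ ⟨i, rfl⟩
      exact (isHomogeneous_X _ _).sub (isHomogeneous_X _ _)) (by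
      intro v hv hvδ
      have hl : v ∘ Sum.inl ∈ cone (p.last : Set (ProjSpace N)) :=
        (mem_cone_iff_forall_eval p.last.isClosed).2 fun f hf => by
          rw [← eval_rename]
          refine hv _ ((hφ _).2 ((hI _).2 fun a ha b hb => ?_))
          rw [eval_rename, Sum.elim_comp_inl]
          exact hf a ha
      have hr : v ∘ Sum.inr ∈ cone (q.last : Set (ProjSpace N)) :=
        (mem_cone_iff_forall_eval q.last.isClosed).2 fun f hf => by
          rw [← eval_rename]
          refine hv _ ((hφ _).2 ((hI _).2 fun a ha b hb => ?_))
          rw [eval_rename, Sum.elim_comp_inr]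
          exact hf b hb
      have hzero : ∀ {A : Set (ProjSpace N)} {w : Fin (N + 1) → ℂ} {i : Fin (N + 1)}, w ∈ cone A →
          (∀ x ∈ A, coords x i = 0) → w i = 0 := fun {A w i} hw hA => by
        by_cases hw0 : w = 0
        · rw [hw0]; rfl
        · exact (coords_mk_eq_zero_iff hw0 i).1 (hA _ (hw hw0))
      have heq : v ∘ Sum.inl = v ∘ Sum.inr := funext fun i => by
        by_cases hi : i ∈ J
        · have := hvδ (δ ⟨i, hi⟩) (Submodule.subset_span ⟨_, rfl⟩)
          simpa [δ, sub_eq_zero] using this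
        · rw [hzero hl fun x hx => hp x hx i hi, hzero hr fun x hx => hq x hx i hi]
      have h0 : v ∘ Sum.inl = 0 := by
        by_contra h0
        exact Set.disjoint_left.1 hpq (hl h0) ((heq ▸ hr) h0)
      rw [← Sum.elim_comp_inl_inr v, ← heq, h0]
      ext (i | i) <;> rfl)
  have hup := ringKrullDim_le_of_linearPart_pow_succ_le φ (Ideal.Quotient.mkₐ_surjective ℂ I)
    (fun i => φ (δ i)) (r := r') fun k hk => by
      refine (hr' k hk).trans_eq ?_
      rw [Submodule.map_span, ← Set.range_comp]
      rfl
  have := hlow.trans hup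
  rw [Nat.card_eq_fintype_card, Fintype.card_coe] at this
  exact_mod_cast this

end ProjSpace

/-! ### Growth of Hilbert functions -/

section Functions

variable {σ : Type*}

/-- Polynomials as functions on a set. -/
noncomputable def MvPolynomial.restrictHom (S : Set (σ → ℂ)) : MvPolynomial σ ℂ →ₐ[ℂ] (S → ℂ) :=
  AlgHom.pi fun v => aeval v.1

@[simp]
theorem MvPolynomial.restrictHom_apply (S : Set (σ → ℂ)) (f : MvPolynomial σ ℂ) (v : S) :
    restrictHom S f v = eval v.1 f := by
  rfl

theorem MvPolynomial.restrictHom_eq_zero_iff {S : Set (σ → ℂ)} {f : MvPolynomial σ ℂ} :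
    restrictHom S f = 0 ↔ ∀ v ∈ S, eval v f = 0 := by
  simp [_root_.funext_iff]

/-- The linear form with given coefficients. -/
noncomputable def MvPolynomial.linearForm [Fintype σ] (c : σ → ℂ) : MvPolynomial σ ℂ :=
  ∑ i, C (c i) * X i

theorem MvPolynomial.isHomogeneous_linearForm [Fintype σ] (c : σ → ℂ) :
    (linearForm c).IsHomogeneous 1 :=
  IsHomogeneous.sum _ _ _ fun _ _ => isHomogeneous_C_mul_X _ _

theorem MvPolynomial.eval_linearForm [Fintype σ] (c v : σ → ℂ) :
    eval v (linearForm c) = c ⬝ᵥ v := by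
  simp [linearForm, dotProduct]

variable {B : Type*} [CommRing B] [Algebra ℂ B] {φ : MvPolynomial σ ℂ →ₐ[ℂ] B}

theorem finrank_map_mulLeft_linearPart_pow (hφ : (RingHom.ker φ).IsPrime) {ℓ : MvPolynomial σ ℂ}
    (hℓ : φ ℓ ≠ 0) (k : ℕ) :
    Module.finrank ℂ ((linearPart φ ^ k).map (LinearMap.mulLeft ℂ (φ ℓ))) =
      Module.finrank ℂ ↥(linearPart φ ^ k) := by
  rw [← LinearMap.range_domRestrict]
  refine LinearMap.finrank_range_of_inj ((injective_iff_map_eq_zero _).2 ?_)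
  rintro ⟨b, hb⟩ h
  obtain ⟨f, -, rfl⟩ := mem_linearPart_pow.1 hb
  have h' : φ (ℓ * f) = 0 := by rw [map_mul]; exact h
  exact Subtype.ext ((hφ.mem_or_mem (show ℓ * f ∈ RingHom.ker φ from h')).resolve_left hℓ)

theorem map_mulLeft_linearPart_pow_le {ℓ : MvPolynomial σ ℂ} (hℓ : ℓ.IsHomogeneous 1) (k : ℕ) :
    (linearPart φ ^ k).map (LinearMap.mulLeft ℂ (φ ℓ)) ≤ linearPart φ ^ (k + 1) := by
  rintro _ ⟨b, hb, rfl⟩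
  obtain ⟨f, hf, rfl⟩ := mem_linearPart_pow.1 hb
  refine mem_linearPart_pow.2 ⟨ℓ * f, ?_, by simp⟩
  rw [add_comm]
  exact hℓ.mul hf

theorem span_singleton_mul_eq_map_mulLeft (b : B) (V : Submodule ℂ B) :
    Submodule.span ℂ {b} * V = V.map (LinearMap.mulLeft ℂ b) := by
  ext x
  rw [Submodule.mem_span_singleton_mul, Submodule.mem_map]
  rfl

/-- If two linear forms generate everything in large degree then the Hilbert function is
eventually concave. -/
theorem finrank_linearPart_pow_concave [Finite σ] (hφ : (RingHom.ker φ).IsPrime)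
    {ℓ m : MvPolynomial σ ℂ} (hℓ : ℓ.IsHomogeneous 1) (hm : m.IsHomogeneous 1) (hℓ0 : φ ℓ ≠ 0)
    (hm0 : φ m ≠ 0) {k : ℕ}
    (h : linearPart φ ^ (k + 2) ≤ Submodule.span ℂ {φ ℓ, φ m} * linearPart φ ^ (k + 1)) :
    Module.finrank ℂ ↥(linearPart φ ^ (k + 2)) + Module.finrank ℂ ↥(linearPart φ ^ k) ≤
      2 * Module.finrank ℂ ↥(linearPart φ ^ (k + 1)) := by
  rw [Submodule.span_insert, Submodule.sup_mul, span_singleton_mul_eq_map_mulLeft,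
    span_singleton_mul_eq_map_mulLeft] at h
  set V := linearPart φ ^ (k + 1) with hV
  have h1 := Submodule.finrank_sup_add_finrank_inf_eq (V.map (LinearMap.mulLeft ℂ (φ ℓ)))
    (V.map (LinearMap.mulLeft ℂ (φ m)))
  rw [finrank_map_mulLeft_linearPart_pow hφ hℓ0, finrank_map_mulLeft_linearPart_pow hφ hm0, ← hV]
    at h1
  -- The intersection of `ℓ V` and `m V` contains `ℓ m` times the piece of degree `k`; this is what
  -- makes the second difference at most zero.
  have h2 : (linearPart φ ^ k).map (LinearMap.mulLeft ℂ (φ (ℓ * m))) ≤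
      V.map (LinearMap.mulLeft ℂ (φ ℓ)) ⊓ V.map (LinearMap.mulLeft ℂ (φ m)) := by
    rintro _ ⟨b, hb, rfl⟩
    refine ⟨⟨φ m * b, map_mulLeft_linearPart_pow_le hm k ⟨b, hb, rfl⟩, ?_⟩,
      ⟨φ ℓ * b, map_mulLeft_linearPart_pow_le hℓ k ⟨b, hb, rfl⟩, ?_⟩⟩
    · simp
    · simp only [LinearMap.mulLeft_apply, map_mul]
      ring
  have h3 := Submodule.finrank_mono h2
  rw [finrank_map_mulLeft_linearPart_pow hφ fun h0 =>
    ((hφ.mem_or_mem (show ℓ * m ∈ RingHom.ker φ from h0)).elim hℓ0 hm0)] at h3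
  have h4 := Submodule.finrank_mono h
  lia

/-- From `r` on, the differences are positive integers which do not increase. Once the least one,
`δ`, is attained, they stay there. -/
theorem exists_eventually_linear_of_concave {h : ℕ → ℕ} (hmono : ∀ k, h k + 1 ≤ h (k + 1)) {r : ℕ}
    (hc : ∀ k ≥ r, h (k + 2) + h k ≤ 2 * h (k + 1)) :
    ∃ a c : ℤ, 1 ≤ a ∧ ∃ k₀, ∀ k ≥ k₀, (h k : ℤ) = a * k + c := by
  classical
  have hex : ∃ δ, ∃ k ≥ r, h (k + 1) = h k + δ := ⟨h (r + 1) - h r, r, le_rfl, by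
    have := hmono r; lia⟩
  obtain ⟨k₀, hk₀, hδ⟩ := Nat.find_spec hex
  set δ := Nat.find hex
  have hmin : ∀ k ≥ r, h k + δ ≤ h (k + 1) := fun k hk => by
    have := Nat.find_min' hex ⟨k, hk, show h (k + 1) = h k + (h (k + 1) - h k) by
      have := hmono k; lia⟩
    have := hmono k
    lia
  have hstep : ∀ j, h (k₀ + j + 1) = h (k₀ + j) + δ := by
    intro j
    induction j with
    | zero => exact hδ
    | succ j ih =>
      have h1 := hc (k₀ + j) (by lia)
      have h2 := hmin (k₀ + j + 1) (by lia)
      have e1 : k₀ + (j + 1) + 1 = k₀ + j + 2 := by lia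
      have e2 : k₀ + (j + 1) = k₀ + j + 1 := by lia
      have e3 : k₀ + j + 1 + 1 = k₀ + j + 2 := by lia
      rw [e3] at h2
      rw [e1, e2]
      lia
  have hval : ∀ j, h (k₀ + j) = h k₀ + δ * j := by
    intro j
    induction j with
    | zero => simp
    | succ j ih => rw [← add_assoc, hstep, ih]; ring
  refine ⟨δ, h k₀ - δ * k₀, ?_, k₀, fun k hk => ?_⟩
  · have := hmono k₀; lia
  · obtain ⟨j, rfl⟩ := Nat.exists_eq_add_of_le hk
    rw [hval]
    push_cast
    ring

end Functions

/-! ### Hilbert functions of curves and a characterization of lines -/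

namespace ProjSpace

variable {N : ℕ}

open TopologicalSpace

/-- The Hilbert function of a subset of projective space. -/
noncomputable def hilbertFunction (X : Set (ProjSpace N)) (k : ℕ) : ℕ :=
  Module.finrank ℂ ↥(linearPart (restrictHom (cone X)) ^ k)

theorem isPrime_ker_restrictHom {X : Set (ProjSpace N)} (hX : IsIrreducible X) :
    (RingHom.ker (restrictHom (cone X))).IsPrime := by
  convert isPrime_coneIdeal hX using 1
  ext f
  rw [RingHom.mem_ker, restrictHom_eq_zero_iff, mem_coneIdeal]

theorem restrictHom_cone_homogeneousComponent {X : Set (ProjSpace N)}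
    {f : MvPolynomial (Fin (N + 1)) ℂ} (hf : restrictHom (cone X) f = 0) (k : ℕ) :
    restrictHom (cone X) (homogeneousComponent k f) = 0 := by
  rw [restrictHom_eq_zero_iff, ← mem_coneIdeal] at hf ⊢
  exact homogeneousComponent_mem_coneIdeal hf k

theorem restrictHom_cone_ne_zero {X : Set (ProjSpace N)} {p : ProjSpace N} (hp : p ∈ X)
    {f : MvPolynomial (Fin (N + 1)) ℂ} (h : eval p.coords f ≠ 0) : restrictHom (cone X) f ≠ 0 :=
  fun h0 => h (restrictHom_eq_zero_iff.1 h0 _ (coords_mem_cone.2 hp))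

theorem exists_linearForm_separating {p q : ProjSpace N} (hpq : p ≠ q) :
    ∃ c : Fin (N + 1) → ℂ, c ⬝ᵥ p.coords = 0 ∧ c ⬝ᵥ q.coords ≠ 0 := by
  by_contra! h
  refine hpq ?_
  rw [← p.mk_coords, ← q.mk_coords]
  refine mk_eq_mk_of_mul_eq _ _ fun i j => ?_
  -- The form `p i * X j - p j * X i` vanishes at `p`; if all of these vanish at `q`, the points
  -- agree.
  have := h (Pi.single j (p.coords i) - Pi.single i (p.coords j)) (by simp [mul_comm])
  simpa [sub_eq_zero] using this

/-- Multiplication by a linear form which vanishes at `p` but not at `q` is injective into the next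
degree. Its image misses a power of a coordinate that is nonzero at `p`. -/
theorem hilbertFunction_lt {X : Set (ProjSpace N)} (hX : IsIrreducible X) (hX' : X.Nontrivial)
    (k : ℕ) : hilbertFunction X k + 1 ≤ hilbertFunction X (k + 1) := by
  obtain ⟨p, hp, q, hq, hpq⟩ := hX'
  obtain ⟨c, hcp, hcq⟩ := exists_linearForm_separating hpq
  rw [← eval_linearForm] at hcp hcq
  have hℓ := isHomogeneous_linearForm c
  set ℓ := linearForm c
  obtain ⟨i, hi⟩ : ∃ i, p.coords i ≠ 0 := Function.ne_iff.1 p.coords_ne_zero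
  have hprime := isPrime_ker_restrictHom hX
  rw [hilbertFunction, hilbertFunction,
    ← finrank_map_mulLeft_linearPart_pow hprime (restrictHom_cone_ne_zero hq hcq)]
  refine Submodule.finrank_lt_finrank_of_lt
    (lt_of_le_of_ne (map_mulLeft_linearPart_pow_le hℓ k) fun heq => ?_)
  have hmem : restrictHom (cone X) (MvPolynomial.X i ^ (k + 1)) ∈
      linearPart (restrictHom (cone X)) ^ (k + 1) :=
    mem_linearPart_pow.2 ⟨_, isHomogeneous_X_pow _ _, rfl⟩
  rw [← heq] at hmem
  obtain ⟨b, -, hb⟩ := hmem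
  have := congrFun hb ⟨p.coords, coords_mem_cone.2 hp⟩
  simp only [LinearMap.mulLeft_apply, Pi.mul_apply, restrictHom_apply, hcp, zero_mul, map_pow,
    eval_X] at this
  exact pow_ne_zero _ hi this.symm

/-- Linear forms without common zero on `X` generate its coordinate ring in large degree. -/
theorem exists_pow_succ_le_of_no_common_zero {X : Set (ProjSpace N)} (hX : IsClosed X)
    {s : Set (MvPolynomial (Fin (N + 1)) ℂ)} (hs : ∀ f ∈ s, f.IsHomogeneous 1)
    (h : ∀ p ∈ X, ∃ f ∈ s, eval p.coords f ≠ 0) :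
    ∃ r, ∀ k ≥ r, linearPart (restrictHom (cone X)) ^ (k + 1) ≤
      Submodule.span ℂ (restrictHom (cone X) '' s) * linearPart (restrictHom (cone X)) ^ k := by
  obtain ⟨r, hr⟩ := exists_linearPart_pow_succ_le (restrictHom (cone X))
    (fun f hf k => restrictHom_cone_homogeneousComponent hf k) (F := Submodule.span ℂ s)
    (Submodule.span_le.2 hs) (by
      intro v hv hvs
      by_contra hv0
      have hvX : v ∈ cone X :=
        (mem_cone_iff_forall_eval hX).2 fun f hf => hv f (restrictHom_eq_zero_iff.2 hf)
      obtain ⟨f, hf, hfv⟩ := h _ (hvX hv0)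
      exact hfv ((eval_coords_mk_eq_zero_iff (hs f hf) v hv0).2
        (hvs f (Submodule.subset_span hf))))
  refine ⟨r, fun k hk => (hr k hk).trans_eq ?_⟩
  rw [Submodule.map_span]
  rfl

/-- Every linear form has a zero on a variety with at least two points. -/
theorem exists_eval_linear_eq_zero {X : Set (ProjSpace N)} (hX : IsVariety X)
    (hX' : X.Nontrivial) {ℓ : MvPolynomial (Fin (N + 1)) ℂ} (hℓ : ℓ.IsHomogeneous 1) :
    ∃ p ∈ X, eval p.coords ℓ = 0 := by
  -- Otherwise `ℓ` alone would generate the coordinate ring in large degree, and the Hilbert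
  -- function could not keep growing.
  by_contra! h
  obtain ⟨r, hr⟩ := exists_pow_succ_le_of_no_common_zero hX.isClosed (s := {ℓ})
    (by simpa using hℓ) (by simpa using h)
  have h1 := hr r le_rfl
  rw [Set.image_singleton, span_singleton_mul_eq_map_mulLeft] at h1
  obtain ⟨p, hp⟩ := hX'.nonempty
  have h2 := Submodule.finrank_mono h1
  rw [finrank_map_mulLeft_linearPart_pow (isPrime_ker_restrictHom hX.isIrreducible)
    (restrictHom_cone_ne_zero hp (h p hp))] at h2
  have := hilbertFunction_lt hX.isIrreducible hX' r
  unfold hilbertFunction at this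
  lia

/-- Proper closed subsets of a curve are finite. -/
theorem finite_of_ssubset {X Z : Set (ProjSpace N)} (hX : IsVariety X) (hd : dim X = 1)
    (hZ : IsClosed Z) (hZX : Z ⊂ X) : Z.Finite := by
  obtain ⟨S, hSf, hSc, hSi, rfl⟩ := NoetherianSpace.exists_finite_set_isClosed_irreducible hZ
  refine hSf.sUnion fun t ht => ?_
  refine Set.Subsingleton.finite fun x hx y hy => ?_
  by_contra hxy
  let t' : IrreducibleCloseds (ProjSpace N) := ⟨t, hSi t ht, hSc t ht⟩
  let X' : IrreducibleCloseds (ProjSpace N) := ⟨X, hX.isIrreducible, hX.isClosed⟩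
  -- A component with two points would give a chain `{x} < t < X` of length `2` in a curve.
  have h1 : ({x} : IrreducibleCloseds (ProjSpace N)) < t' := by
    refine lt_of_le_not_ge (fun z hz => ?_) fun hle => hxy ?_
    · rw [IrreducibleCloseds.mem_singleton.1 hz]; exact hx
    · exact (IrreducibleCloseds.mem_singleton.1 (hle hy)).symm
  have h2 : t' < X' := by
    refine lt_of_le_not_ge (fun z hz => hZX.1 ⟨t, ht, hz⟩) fun hle => hZX.2 fun z hz => ?_
    exact ⟨t, ht, hle hz⟩
  let p : LTSeries (IrreducibleCloseds (ProjSpace N)) :=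
    LTSeries.mk 2 ![{x}, t', X'] (Fin.strictMono_iff_lt_succ.2 fun i => by
      fin_cases i
      · exact h1
      · exact h2)
  have := length_le_dim p (X := X) le_rfl
  rw [hd] at this
  exact absurd this (show ¬ ((2 : ℕ) : WithBot ℕ∞) ≤ 1 by decide)

/-- On a curve there are two nonzero linear forms without common zero. -/
theorem exists_linear_pair {X : Set (ProjSpace N)} (hX : IsVariety X) (hd : dim X = 1) :
    ∃ ℓ m : MvPolynomial (Fin (N + 1)) ℂ, ℓ.IsHomogeneous 1 ∧ m.IsHomogeneous 1 ∧
      restrictHom (cone X) ℓ ≠ 0 ∧ restrictHom (cone X) m ≠ 0 ∧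
      ∀ p ∈ X, ∃ f ∈ ({ℓ, m} : Set (MvPolynomial (Fin (N + 1)) ℂ)), eval p.coords f ≠ 0 := by
  obtain ⟨q, hq⟩ := hX.isIrreducible.nonempty
  obtain ⟨i, hi⟩ : ∃ i, q.coords i ≠ 0 := Function.ne_iff.1 q.coords_ne_zero
  have hfin : (X ∩ {p | p.coords i = 0}).Finite :=
    finite_of_ssubset hX hd (hX.isClosed.inter (isClosed_setOf_coords_eq_zero i))
      ⟨Set.inter_subset_left, fun h => hi (h hq).2⟩
  have hfin' := hfin.insert q
  let K : ↥(insert q (X ∩ {p | p.coords i = 0})) → Subspace ℂ (Fin (N + 1) → ℂ) := fun p =>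
    { carrier := {c | c ⬝ᵥ p.1.coords = 0}
      add_mem' := fun {a b} ha hb => by
        simp only [Set.mem_ofPred_eq] at ha hb ⊢
        rw [add_dotProduct, ha, hb, add_zero]
      zero_mem' := by simp
      smul_mem' := fun c x hx => by
        simp only [Set.mem_ofPred_eq] at hx ⊢
        rw [smul_dotProduct, hx, smul_zero] }
  have : Finite ↥(insert q (X ∩ {p | p.coords i = 0})) := hfin'
  -- Over an infinite field finitely many proper subspaces do not cover, so some form avoids the
  -- finitely many zeros of `X i` on the curve. The point `q` is included so that this form is not
  -- zero on `X`.
  have hne : ⋃ p, (K p : Set (Fin (N + 1) → ℂ)) ≠ Set.univ := fun h => by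
    obtain ⟨p, hp⟩ := Subspace.exists_eq_top_of_iUnion_eq_univ h
    obtain ⟨j, hj⟩ : ∃ j, p.1.coords j ≠ 0 := Function.ne_iff.1 p.1.coords_ne_zero
    have : Pi.single j 1 ∈ K p := hp ▸ Submodule.mem_top
    exact hj (by simpa [K] using this)
  obtain ⟨c, hc⟩ := (Set.ne_univ_iff_exists_notMem _).1 hne
  simp only [Set.mem_iUnion, not_exists] at hc
  have hc' : ∀ p ∈ insert q (X ∩ {p | p.coords i = 0}), eval p.coords (linearForm c) ≠ 0 :=
    fun p hp => by
      rw [eval_linearForm]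
      exact hc ⟨p, hp⟩
  refine ⟨MvPolynomial.X i, linearForm c, isHomogeneous_X _ _, isHomogeneous_linearForm c,
    restrictHom_cone_ne_zero hq (by simpa using hi),
    restrictHom_cone_ne_zero hq (hc' q (Set.mem_insert _ _)), fun p hp => ?_⟩
  by_cases hpi : p.coords i = 0
  · exact ⟨_, Or.inr rfl, hc' p (Set.mem_insert_of_mem _ ⟨hp, hpi⟩)⟩
  · exact ⟨_, Or.inl rfl, by simpa using hpi⟩

/-- The Hilbert function of a curve is eventually given by a linear polynomial. -/
theorem exists_hilbertFunction_eq {X : Set (ProjSpace N)} (hX : IsVariety X) (hd : dim X = 1)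
    (hX' : X.Nontrivial) :
    ∃ a c : ℤ, 1 ≤ a ∧ ∃ k₀, ∀ k ≥ k₀, (hilbertFunction X k : ℤ) = a * k + c := by
  obtain ⟨ℓ, m, hℓ, hm, hℓ0, hm0, h⟩ := exists_linear_pair hX hd
  obtain ⟨r, hr⟩ := exists_pow_succ_le_of_no_common_zero hX.isClosed (s := {ℓ, m})
    (by simpa using ⟨hℓ, hm⟩) h
  refine exists_eventually_linear_of_concave (hilbertFunction_lt hX.isIrreducible hX') (r := r)
    fun k hk => finrank_linearPart_pow_concave (isPrime_ker_restrictHom hX.isIrreducible) hℓ hm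
      hℓ0 hm0 ?_
  have := hr (k + 1) (by lia)
  rwa [Set.image_pair] at this

/-- A variety with at least two points whose Hilbert function is eventually `k + 1` is a line. -/
theorem isLine_of_hilbertFunction {X : Set (ProjSpace N)} (hX : IsVariety X) (hX' : X.Nontrivial)
    {k₀ : ℕ} (h : ∀ k ≥ k₀, hilbertFunction X k = k + 1) : IsLine X := by
  -- Each step adds at least `1` and the function ends at `k + 1`, so its value in degree `1` is at
  -- most `2`.
  have hup : ∀ j, hilbertFunction X 1 + j ≤ hilbertFunction X (1 + j) := by
    intro j
    induction j with
    | zero => simp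
    | succ j ih =>
      have := hilbertFunction_lt hX.isIrreducible hX' (1 + j)
      rw [← add_assoc]
      lia
  have h1 : hilbertFunction X 1 ≤ 2 := by
    have h1 := hup k₀
    have h2 := h (1 + k₀) (by lia)
    lia
  let E := Submodule.span ℂ (cone X)
  have hE : Module.finrank ℂ E ≤ 2 := by
    -- A functional on `E`, the span of the cone, is determined by its values on the cone and
    -- restricts there to a linear form. So `dim E` is at most the Hilbert function in degree `1`.
    let ρ : Module.Dual ℂ E →ₗ[ℂ] (cone X → ℂ) :=
      { toFun := fun f v => f ⟨v.1, Submodule.subset_span v.2⟩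
        map_add' := fun _ _ => rfl
        map_smul' := fun _ _ => rfl }
    have hρ : ∀ f, ρ f ∈ linearPart (restrictHom (cone X)) ^ 1 := fun f => by
      obtain ⟨g, hg⟩ := LinearMap.exists_extend f
      refine mem_linearPart_pow.2 ⟨linearForm fun i => g (Pi.single i 1),
        isHomogeneous_linearForm _, funext fun v => ?_⟩
      rw [restrictHom_apply, eval_linearForm]
      change _ = f ⟨v.1, Submodule.subset_span v.2⟩
      rw [← hg, LinearMap.comp_apply, Submodule.subtype_apply]
      conv_rhs => rw [← LinearMap.sum_single_apply (fun _ => ℂ) v.1, map_sum]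
      refine Finset.sum_congr rfl fun i _ => ?_
      rw [mul_comm, ← smul_eq_mul, ← map_smul, ← Pi.single_smul,
        smul_eq_mul, mul_one]
    have hinj : Function.Injective (ρ.codRestrict _ hρ) := by
      refine (injective_iff_map_eq_zero _).2 fun f hf => LinearMap.ext fun x => ?_
      obtain ⟨x, hx⟩ := x
      induction hx using Submodule.span_induction with
      | mem x hx => exact congrFun (congrArg Subtype.val hf) ⟨x, hx⟩
      | zero => exact map_zero f
      | add x y hx hy h1 h2 =>
        rw [LinearMap.zero_apply] at h1 h2 ⊢
        rw [← zero_add (0 : ℂ)]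
        nth_rewrite 1 [← h1]
        rw [← h2, ← map_add]
        rfl
      | smul a x hx h1 =>
        rw [LinearMap.zero_apply] at h1 ⊢
        rw [← smul_zero a, ← h1, ← map_smul]
        rfl
    have := LinearMap.finrank_le_finrank_of_injective hinj
    rw [Subspace.dual_finrank_eq] at this
    exact this.trans h1
  have hspan : ∀ p q : ProjSpace N, p ≠ q → p.coords ∈ E → q.coords ∈ E →
      Submodule.span ℂ (Set.range ![p.coords, q.coords]) = E ∧ Module.finrank ℂ E = 2 := by
    intro p q hpq hp hq
    have hli : LinearIndependent ℂ ![p.coords, q.coords] := by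
      rw [LinearIndependent.pair_iff' p.coords_ne_zero]
      intro a ha
      refine hpq ?_
      rw [← p.mk_coords, ← q.mk_coords, eq_comm, mk_eq_mk_iff]
      exact ⟨a, ha⟩
    have hcard := finrank_span_eq_card hli
    have hle : Submodule.span ℂ (Set.range ![p.coords, q.coords]) ≤ E := by
      rw [Submodule.span_le]
      rintro _ ⟨i, rfl⟩
      fin_cases i
      · exact hp
      · exact hq
    rw [Fintype.card_fin] at hcard
    have heq := Submodule.eq_of_le_of_finrank_le hle (by rw [hcard]; exact hE)
    exact ⟨heq, heq ▸ hcard⟩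
  have hXE : ∀ p ∈ X, p.coords ∈ E := fun p hp => Submodule.subset_span (coords_mem_cone.2 hp)
  refine ⟨E, ?_, Set.Subset.antisymm hXE fun z hz => ?_⟩
  · obtain ⟨p, hp, q, hq, hpq⟩ := hX'
    exact (hspan p q hpq (hXE p hp) (hXE q hq)).2
  · by_contra hzX
    obtain ⟨p, hp⟩ := hX'.nonempty
    have hzp : z ≠ p := fun h => hzX (h ▸ hp)
    -- This form has a zero on `X`. Its only zero on the line of `E` is `z`, since it does not
    -- vanish at `p`; hence `z ∈ X`.
    obtain ⟨c, hcz, hcp⟩ := exists_linearForm_separating hzp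
    obtain ⟨x, hx, hxc⟩ := exists_eval_linear_eq_zero hX hX' (isHomogeneous_linearForm c)
    have hxE := hXE x hx
    rw [← (hspan z p hzp hz (hXE p hp)).1, Matrix.range_cons, Matrix.range_cons,
      Matrix.range_empty, Set.union_empty, Set.singleton_union, Submodule.mem_span_pair] at hxE
    obtain ⟨a, b, hab⟩ := hxE
    rw [eval_linearForm, ← hab, dotProduct_add, dotProduct_smul, dotProduct_smul, hcz, smul_zero,
      zero_add, smul_eq_mul, mul_eq_zero] at hxc
    rw [hxc.resolve_right hcp, zero_smul, add_zero] at hab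
    have : x = z := by
      rw [← x.mk_coords, ← z.mk_coords, mk_eq_mk_iff]
      exact ⟨a, hab⟩
    exact hzX (this ▸ hx)

end ProjSpace

/-! ### Comparison of the Segre and Hadamard coordinate rings -/

section ProductFunctions

variable {α β : Type*}

/-- Functions of the first variable. -/
def pullFst (α β : Type*) : (α → ℂ) →ₐ[ℂ] (α × β → ℂ) := AlgHom.pi fun z => Pi.evalAlgHom ℂ _ z.1

/-- Functions of the second variable. -/
def pullSnd (α β : Type*) : (β → ℂ) →ₐ[ℂ] (α × β → ℂ) := AlgHom.pi fun z => Pi.evalAlgHom ℂ _ z.2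

@[simp] theorem pullFst_apply (f : α → ℂ) (z : α × β) : pullFst α β f z = f z.1 := rfl

@[simp] theorem pullSnd_apply (f : β → ℂ) (z : α × β) : pullSnd α β f z = f z.2 := rfl

/-- Products of functions in separate variables form a tensor product. -/
theorem finrank_map_pullFst_mul_map_pullSnd (U : Submodule ℂ (α → ℂ)) (V : Submodule ℂ (β → ℂ))
    [FiniteDimensional ℂ U] [FiniteDimensional ℂ V] :
    Module.finrank ℂ ↥(U.map (pullFst α β).toLinearMap * V.map (pullSnd α β).toLinearMap) =
      Module.finrank ℂ U * Module.finrank ℂ V := by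
  let u := Module.finBasis ℂ U
  let v := Module.finBasis ℂ V
  have hu : Submodule.span ℂ (Set.range fun i => (u i : α → ℂ)) = U := by
    have := congrArg (Submodule.map U.subtype) u.span_eq
    rwa [Submodule.map_span, Submodule.map_top, Submodule.range_subtype, ← Set.range_comp] at this
  have hv : Submodule.span ℂ (Set.range fun i => (v i : β → ℂ)) = V := by
    have := congrArg (Submodule.map V.subtype) v.span_eq
    rwa [Submodule.map_span, Submodule.map_top, Submodule.range_subtype, ← Set.range_comp] at this
  let b : Fin (Module.finrank ℂ U) × Fin (Module.finrank ℂ V) → α × β → ℂ := fun ij z =>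
    (u ij.1 : α → ℂ) z.1 * (v ij.2 : β → ℂ) z.2
  have hb : LinearIndependent ℂ b := by
    rw [Fintype.linearIndependent_iff]
    rintro c hc ⟨i, j⟩
    -- With `y` frozen, independence of the `u i` separates the sum; independence of the `v j` then
    -- finishes.
    have h1 : ∀ y : β, ∀ i, ∑ j, c (i, j) * (v j : β → ℂ) y = 0 := by
      intro y
      refine Fintype.linearIndependent_iff.1 u.linearIndependent
        (fun i => ∑ j, c (i, j) * (v j : β → ℂ) y) (Subtype.ext (funext fun x => ?_))
      have := congrFun hc (x, y)
      rw [Fintype.sum_prod_type] at this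
      simp only [Finset.sum_apply, Pi.smul_apply, smul_eq_mul, Pi.zero_apply, b] at this
      rw [Submodule.coe_sum]
      simp only [Finset.sum_apply, Submodule.coe_smul, Pi.smul_apply, smul_eq_mul, Finset.sum_mul,
        Submodule.coe_zero, Pi.zero_apply]
      rw [← this]
      exact Finset.sum_congr rfl fun i _ => Finset.sum_congr rfl fun j _ => by ring
    refine Fintype.linearIndependent_iff.1 v.linearIndependent (fun j => c (i, j))
      (Subtype.ext (funext fun y => ?_)) j
    rw [Submodule.coe_sum]
    simpa using h1 y i
  have hspan : U.map (pullFst α β).toLinearMap * V.map (pullSnd α β).toLinearMap =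
      Submodule.span ℂ (Set.range b) := by
    conv_lhs => rw [← hu, ← hv]
    rw [Submodule.map_span, Submodule.map_span, Submodule.span_mul_span, ← Set.range_comp,
      ← Set.range_comp, ← Set.image2_mul, Set.image2_range]
    rfl
  rw [hspan, finrank_span_eq_card hb]
  simp

end ProductFunctions

theorem linearPart_comp_pow {σ B B' : Type*} [CommRing B] [Algebra ℂ B] [CommRing B']
    [Algebra ℂ B'] (g : B →ₐ[ℂ] B') (φ : MvPolynomial σ ℂ →ₐ[ℂ] B) (k : ℕ) :
    linearPart (g.comp φ) ^ k = (linearPart φ ^ k).map g.toLinearMap := by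
  rw [linearPart_pow, linearPart_pow, ← Submodule.map_comp]
  rfl

theorem MvPolynomial.eval_homogeneousComponent_eq {σ : Type*} {a : MvPolynomial σ ℂ} {v : σ → ℂ}
    {m : ℕ} {z : ℂ} (h : ∀ t : ℂ, eval (t • v) a = t ^ m * z) :
    eval v (homogeneousComponent m a) = z := by
  classical
  have key := eq_zero_of_forall_sum_pow_mul_eq_zero
    (s := insert m (Finset.range (a.totalDegree + 1)))
    (c := fun k => eval v (homogeneousComponent k a) - if k = m then z else 0) (k := m) (by
      intro t
      simp only [mul_sub, Finset.sum_sub_distrib, mul_ite, mul_zero]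
      rw [Finset.sum_ite_eq', if_pos (Finset.mem_insert_self _ _), ← h t, eval_smul_eq_sum,
        sub_eq_zero]
      refine (Finset.sum_subset (Finset.subset_insert _ _) fun k _ hk => ?_).symm
      rw [homogeneousComponent_eq_zero_of_notMem a hk, map_zero, mul_zero])
    (Finset.mem_insert_self _ _)
  simpa [sub_eq_zero] using key

/-- If `T` is generated over `L` in large degree and `L ^ s` conducts `T` into the powers of `L`,
then the powers of `T` and `L` agree eventually. -/
theorem Submodule.exists_forall_pow_eq_pow {B : Type*} [CommRing B] [Algebra ℂ B]
    {L T : Submodule ℂ B} (hLT : L ≤ T) {r s : ℕ} (h₁ : ∀ k ≥ r, T ^ (k + 1) ≤ L * T ^ k)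
    (h₂ : L ^ s * T ≤ L ^ (s + 1)) : ∃ k₀, ∀ k ≥ k₀, T ^ k = L ^ k := by
  have h3 : ∀ j, T ^ (r + j) ≤ L ^ j * T ^ r := by
    intro j
    induction j with
    | zero => simp
    | succ j ih =>
      calc T ^ (r + (j + 1)) ≤ L * T ^ (r + j) := h₁ (r + j) (by lia)
        _ ≤ L * (L ^ j * T ^ r) := mul_le_mul' le_rfl ih
        _ = L ^ (j + 1) * T ^ r := by ring
  have h4 : ∀ i, L ^ s * T ^ i ≤ L ^ (s + i) := by
    intro i
    induction i with
    | zero => simp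
    | succ i ih =>
      calc L ^ s * T ^ (i + 1) = L ^ s * T ^ i * T := by ring
        _ ≤ L ^ (s + i) * T := mul_le_mul' ih le_rfl
        _ = L ^ i * (L ^ s * T) := by ring
        _ ≤ L ^ i * L ^ (s + 1) := mul_le_mul' le_rfl h₂
        _ = L ^ (s + (i + 1)) := by ring
  refine ⟨r + s, fun k hk => le_antisymm ?_ (pow_le_pow_left' hLT k)⟩
  obtain ⟨j, rfl⟩ := Nat.exists_eq_add_of_le hk
  calc T ^ (r + s + j) = T ^ (r + (s + j)) := by rw [add_assoc]
    _ ≤ L ^ (s + j) * T ^ r := h3 _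
    _ = L ^ j * (L ^ s * T ^ r) := by ring
    _ ≤ L ^ j * L ^ (s + r) := mul_le_mul' le_rfl (h4 r)
    _ = L ^ (r + s + j) := by ring

namespace ProjSpace

variable {N : ℕ} (X Y : Set (ProjSpace N))

/-- Forms in the products `x i * y j`, as functions on the product of the cones. -/
noncomputable def segreHom :
    MvPolynomial (Fin (N + 1) × Fin (N + 1)) ℂ →ₐ[ℂ] (cone X × cone Y → ℂ) :=
  AlgHom.pi fun z => aeval fun ij => z.1.1 ij.1 * z.2.1 ij.2

/-- Forms in the products `x i * y i`, as functions on the product of the cones. -/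
noncomputable def hadamardHom :
    MvPolynomial (Fin (N + 1)) ℂ →ₐ[ℂ] (cone X × cone Y → ℂ) :=
  AlgHom.pi fun z => aeval (z.1.1 * z.2.1)

variable {X Y}

@[simp]
theorem segreHom_apply (f : MvPolynomial (Fin (N + 1) × Fin (N + 1)) ℂ) (z : cone X × cone Y) :
    segreHom X Y f z = eval (fun ij => z.1.1 ij.1 * z.2.1 ij.2) f := rfl

@[simp]
theorem hadamardHom_apply (f : MvPolynomial (Fin (N + 1)) ℂ) (z : cone X × cone Y) :
    hadamardHom X Y f z = eval (z.1.1 * z.2.1) f := rfl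

theorem linearPart_segreHom : linearPart (segreHom X Y) =
    linearPart ((pullFst _ (cone Y)).comp (restrictHom (cone X))) *
      linearPart ((pullSnd (cone X) _).comp (restrictHom (cone Y))) := by
  rw [linearPart_eq_span, linearPart_eq_span, linearPart_eq_span, Submodule.span_mul_span,
    ← Set.image2_mul, Set.image2_range]
  congr 2
  funext ij z
  simp

/-- The piece of bidegree `(k, k)` is the tensor product of the pieces of degree `k` of the two
factors. -/
theorem finrank_linearPart_segreHom_pow (k : ℕ) :
    Module.finrank ℂ ↥(linearPart (segreHom X Y) ^ k) =
      hilbertFunction X k * hilbertFunction Y k := by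
  rw [linearPart_segreHom, mul_pow, linearPart_comp_pow, linearPart_comp_pow,
    finrank_map_pullFst_mul_map_pullSnd]
  rfl

theorem linearPart_hadamardHom_le : linearPart (hadamardHom X Y) ≤ linearPart (segreHom X Y) := by
  rw [linearPart_eq_span, linearPart_eq_span, Submodule.span_le]
  rintro _ ⟨i, rfl⟩
  exact Submodule.subset_span ⟨(i, i), funext fun z => by simp⟩

/-- The hypothesis says that the diagonal forms `x i * y i` have no common zero on the Segre image
of `X × Y`, so they generate its coordinate ring in large degree. -/
theorem exists_segre_pow_succ_le (hX : IsClosed X) (hY : IsClosed Y)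
    (h : ∀ x ∈ cone X, ∀ y ∈ cone Y, x * y = 0 → x = 0 ∨ y = 0) :
    ∃ r, ∀ k ≥ r, linearPart (segreHom X Y) ^ (k + 1) ≤
      linearPart (hadamardHom X Y) * linearPart (segreHom X Y) ^ k := by
  obtain ⟨r, hr⟩ := exists_linearPart_pow_succ_le (segreHom X Y) (by
      intro f hf k
      funext z
      refine eval_homogeneousComponent_eq_zero (fun t => ?_) k
      have := congrFun hf (⟨t • z.1.1, smul_mem_cone z.1.2 t⟩, z.2)
      rw [segreHom_apply, Pi.zero_apply] at this
      rw [← this]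
      congr 2
      funext ij
      simp [mul_assoc])
    (F := Submodule.span ℂ (Set.range fun i => MvPolynomial.X (i, i))) (by
      rw [Submodule.span_le]
      rintro _ ⟨i, rfl⟩
      exact isHomogeneous_X _ _) (by
      intro v hv hvd
      -- A zero of the kernel is a matrix `v` of rank at most one with columns in `cone X` and rows
      -- in `cone Y`. If its diagonal vanishes, column `j` times row `i` has entries `v (k, k) * v
      -- (i, j) = 0`.
      have hd : ∀ i, v (i, i) = 0 := fun i => by
        simpa using hvd _ (Submodule.subset_span ⟨i, rfl⟩)
      have hmin : ∀ i j k l, v (i, j) * v (k, l) = v (i, l) * v (k, j) := fun i j k l => by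
        have := hv (MvPolynomial.X (i, j) * MvPolynomial.X (k, l) -
          MvPolynomial.X (i, l) * MvPolynomial.X (k, j)) (funext fun z => by simp; ring)
        simpa [sub_eq_zero] using this
      have hcol : ∀ j, (fun i => v (i, j)) ∈ cone X := fun j =>
        (mem_cone_iff_forall_eval hX).2 fun f hf => by
          have := hv (rename (fun i => (i, j)) f) (funext fun z => by
            rw [segreHom_apply, eval_rename]
            have := hf _ (smul_mem_cone z.1.2 (z.2.1 j))
            rw [Pi.zero_apply, ← this]
            congr 2
            ext i
            simp [mul_comm])
          rwa [eval_rename] at this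
      have hrow : ∀ i, (fun j => v (i, j)) ∈ cone Y := fun i =>
        (mem_cone_iff_forall_eval hY).2 fun f hf => by
          have := hv (rename (fun j => (i, j)) f) (funext fun z => by
            rw [segreHom_apply, eval_rename]
            exact hf _ (smul_mem_cone z.2.2 (z.1.1 i)))
          rwa [eval_rename] at this
      funext ⟨i, j⟩
      rcases h _ (hcol j) _ (hrow i) (funext fun k => by
        have := hmin k j i k
        simp only [Pi.mul_apply, Pi.zero_apply]
        rw [this, hd, zero_mul]) with h0 | h0
      · exact congrFun h0 i
      · exact congrFun h0 j)
  refine ⟨r, fun k hk => (hr k hk).trans_eq ?_⟩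
  rw [Submodule.map_span, ← Set.range_comp, linearPart_eq_span (hadamardHom X Y)]
  congr 3
  funext i z
  simp

/-- The polynomials `f` for which every `f(x * y) x i y j` is a polynomial in `x * y` form an ideal,
a conductor. By hypothesis it has no zero but possibly the origin, so it contains all forms of some
degree `s`. -/
theorem exists_hadamard_pow_mul_segre_le
    (h : ∀ v : Fin (N + 1) → ℂ, v ≠ 0 → ∃ f : MvPolynomial (Fin (N + 1)) ℂ, eval v f ≠ 0 ∧
      ∀ i j, ∃ g, ∀ x ∈ cone X, ∀ y ∈ cone Y, eval (x * y) f * (x i * y j) = eval (x * y) g) :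
    ∃ s, linearPart (hadamardHom X Y) ^ s * linearPart (segreHom X Y) ≤
      linearPart (hadamardHom X Y) ^ (s + 1) := by
  let c : Ideal (MvPolynomial (Fin (N + 1)) ℂ) :=
    { carrier := {f | ∀ i j, ∃ g, ∀ x ∈ cone X, ∀ y ∈ cone Y,
        eval (x * y) f * (x i * y j) = eval (x * y) g}
      add_mem' := fun {f f'} hf hf' i j => by
        obtain ⟨g, hg⟩ := hf i j
        obtain ⟨g', hg'⟩ := hf' i j
        exact ⟨g + g', fun x hx y hy => by
          rw [map_add, map_add, add_mul, hg x hx y hy, hg' x hx y hy]⟩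
      zero_mem' := fun i j => ⟨0, by simp⟩
      smul_mem' := fun a f hf i j => by
        obtain ⟨g, hg⟩ := hf i j
        exact ⟨a * g, fun x hx y hy => by
          rw [smul_eq_mul, map_mul, map_mul, mul_assoc, hg x hx y hy]⟩ }
  obtain ⟨s, hs⟩ := exists_forall_isHomogeneous_mem c fun v hv => by
    by_contra hv0
    obtain ⟨f, hf, hfc⟩ := h v hv0
    exact hf (hv f hfc)
  refine ⟨s, ?_⟩
  rw [linearPart_eq_span (segreHom X Y), ← Submodule.span_eq (linearPart (hadamardHom X Y) ^ s),
    Submodule.span_mul_span, Submodule.span_le]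
  rintro _ ⟨b, hb, _, ⟨⟨i, j⟩, rfl⟩, rfl⟩
  obtain ⟨f, hf, rfl⟩ := mem_linearPart_pow.1 hb
  obtain ⟨g, hg⟩ := hs s le_rfl f hf i j
  -- The left side has degree `s + 1` in `x`, so scaling `x` by `t` extracts that component of `g`.
  refine mem_linearPart_pow.2 ⟨homogeneousComponent (s + 1) g,
    homogeneousComponent_isHomogeneous _ _, funext fun z => ?_⟩
  rw [hadamardHom_apply]
  refine eval_homogeneousComponent_eq fun t => ?_
  have := hg _ (smul_mem_cone z.1.2 t) _ z.2.2
  rw [smul_mul_assoc] at this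
  rw [← this, hf.eval_smul]
  simp
  ring

/-- Under the two hypotheses the coordinate rings of `X ⋆ Y` and `X × Y` agree in large degree. -/
theorem exists_finrank_hadamard_eq (hX : IsClosed X) (hY : IsClosed Y)
    (h : ∀ x ∈ cone X, ∀ y ∈ cone Y, x * y = 0 → x = 0 ∨ y = 0)
    (h' : ∀ v : Fin (N + 1) → ℂ, v ≠ 0 → ∃ f : MvPolynomial (Fin (N + 1)) ℂ, eval v f ≠ 0 ∧
      ∀ i j, ∃ g, ∀ x ∈ cone X, ∀ y ∈ cone Y, eval (x * y) f * (x i * y j) = eval (x * y) g) :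
    ∃ k₀, ∀ k ≥ k₀, Module.finrank ℂ ↥(linearPart (hadamardHom X Y) ^ k) =
      hilbertFunction X k * hilbertFunction Y k := by
  obtain ⟨r, hr⟩ := exists_segre_pow_succ_le hX hY h
  obtain ⟨s, hs⟩ := exists_hadamard_pow_mul_segre_le h'
  obtain ⟨k₀, hk₀⟩ := Submodule.exists_forall_pow_eq_pow linearPart_hadamardHom_le hr hs
  exact ⟨k₀, fun k hk => by rw [← hk₀ k hk, finrank_linearPart_segreHom_pow]⟩

end ProjSpace

/-! ### Hilbert functions of `ℙ³` and of hypersurfaces, and the numerical comparison -/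

theorem MvPolynomial.finrank_homogeneousSubmodule (n k : ℕ) :
    Module.finrank ℂ (homogeneousSubmodule (Fin n) ℂ k) = (n + k - 1).choose k := by
  classical
  rw [homogeneousSubmodule_eq_finsupp_supported,
    (AddMonoidAlgebra.supportedEquivFinsupp {d : Fin n →₀ ℕ | d.degree = k}).finrank_eq]
  have hset : {d : Fin n →₀ ℕ | d.degree = k} =
      (Finset.finsuppAntidiag (Finset.univ : Finset (Fin n)) k : Set (Fin n →₀ ℕ)) := by
    ext d
    simp [Finset.mem_finsuppAntidiag, Finsupp.degree_eq_sum]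
  rw [hset, Module.finrank_finsupp_self]
  have := Finset.card_finsuppAntidiag_nat_eq_choose (s := (Finset.univ : Finset (Fin n))) k
  rw [Finset.card_fin] at this
  rw [← this]
  simp

theorem Nat.six_mul_add_three_choose (k : ℕ) :
    6 * (k + 3).choose 3 = (k + 3) * (k + 2) * (k + 1) := by
  have := Nat.descFactorial_eq_factorial_mul_choose (k + 3) 3
  simp [Nat.descFactorial, Nat.factorial] at this
  lia

theorem six_mul_finrank_homogeneousSubmodule_four (k : ℕ) :
    (6 * Module.finrank ℂ (homogeneousSubmodule (Fin 4) ℂ k) : ℤ) =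
      (k + 3) * (k + 2) * (k + 1) := by
  rw [finrank_homogeneousSubmodule, show 4 + k - 1 = k + 3 by lia,
    ← Nat.choose_symm (by lia : k ≤ k + 3), Nat.add_sub_cancel_left]
  exact_mod_cast Nat.six_mul_add_three_choose k

/-- The Hilbert function of a hypersurface ring. -/
theorem finrank_linearPart_pow_add {σ B : Type*} [Finite σ] [CommRing B] [Algebra ℂ B]
    (φ : MvPolynomial σ ℂ →ₐ[ℂ] B) {F : MvPolynomial σ ℂ} {e : ℕ} (hF : F.IsHomogeneous e)
    (hF0 : F ≠ 0) (hφ : ∀ f, φ f = 0 ↔ F ∣ f) (k : ℕ) :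
    Module.finrank ℂ ↥(linearPart φ ^ (e + k)) + Module.finrank ℂ (homogeneousSubmodule σ ℂ k) =
      Module.finrank ℂ (homogeneousSubmodule σ ℂ (e + k)) := by
  have : ∀ k, FiniteDimensional ℂ (homogeneousSubmodule σ ℂ k) := fun k =>
    Module.Finite.iff_fg.2 (homogeneousSubmodule_fg σ ℂ k)
  let g := φ.toLinearMap.domRestrict (homogeneousSubmodule σ ℂ (e + k))
  have h1 := LinearMap.finrank_range_add_finrank_ker g
  have h2 : LinearMap.range g = linearPart φ ^ (e + k) := by
    rw [linearPart_pow, LinearMap.range_domRestrict]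
  have h3 : (LinearMap.ker g).map (Submodule.subtype _) =
      (homogeneousSubmodule σ ℂ k).map (LinearMap.mulLeft ℂ F) := by
    ext f
    constructor
    · rintro ⟨⟨f, hf⟩, hf0, rfl⟩
      obtain ⟨q, rfl⟩ := (hφ f).1 hf0
      refine ⟨homogeneousComponent k q, homogeneousComponent_isHomogeneous _ _, ?_⟩
      rw [LinearMap.mulLeft_apply, ← homogeneousComponent_mul_of_isHomogeneous hF,
        homogeneousComponent_eq_self hf]
      rfl
    · rintro ⟨q, hq, rfl⟩
      exact ⟨⟨F * q, hF.mul hq⟩, (hφ _).2 (dvd_mul_right _ _), rfl⟩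
  have h4 := LinearEquiv.finrank_eq (Submodule.equivMapOfInjective (Submodule.subtype _)
    (Submodule.subtype_injective _) (LinearMap.ker g))
  have h5 := LinearEquiv.finrank_eq (Submodule.equivMapOfInjective (LinearMap.mulLeft ℂ F)
    (fun a b h => mul_left_cancel₀ hF0 h) (homogeneousSubmodule σ ℂ k))
  rw [h3, ← h5] at h4
  rw [h2, h4] at h1
  exact h1

theorem finrank_linearPart_pow_of_injective {σ B : Type*} [CommRing B] [Algebra ℂ B]
    (φ : MvPolynomial σ ℂ →ₐ[ℂ] B) (hφ : ∀ f, φ f = 0 → f = 0) (k : ℕ) :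
    Module.finrank ℂ ↥(linearPart φ ^ k) = Module.finrank ℂ (homogeneousSubmodule σ ℂ k) := by
  rw [linearPart_pow]
  exact (LinearEquiv.finrank_eq (Submodule.equivMapOfInjective φ.toLinearMap
    ((injective_iff_map_eq_zero _).2 hφ) (homogeneousSubmodule σ ℂ k))).symm

/-- A cubic polynomial is not eventually a product of two linear ones. -/
theorem not_eventually_cubic_eq {a b c c' : ℤ} {k₀ : ℕ}
    (h : ∀ k : ℕ, k ≥ k₀ → ((k : ℤ) + 3) * (k + 2) * (k + 1) = 6 * ((a * k + c) * (b * k + c'))) :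
    False := by
  have h0 := h k₀ le_rfl
  have h1 := h (k₀ + 1) (by lia)
  have h2 := h (k₀ + 2) (by lia)
  have h3 := h (k₀ + 3) (by lia)
  push_cast at h1 h2 h3
  -- The third difference is `6` for the cubic and `0` for the quadratic side.
  have : (6 : ℤ) = 0 := by linear_combination h3 - 3 * h2 + 3 * h1 - h0
  lia

/-- The Hilbert polynomial of a surface of degree `e` in `ℙ³` is a product of Hilbert polynomials
of curves only if the surface is a quadric and the curves are lines. -/
theorem eq_one_of_hilbert_eq {a b c c' e : ℤ} {k₀ : ℕ} (ha : 1 ≤ a) (hb : 1 ≤ b)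
    (h : ∀ k : ℕ, k ≥ k₀ → (e + k + 3) * (e + k + 2) * (e + k + 1) - (k + 3) * (k + 2) * (k + 1) =
      6 * ((a * (e + k) + c) * (b * (e + k) + c'))) :
    e = 2 ∧ a = 1 ∧ b = 1 ∧ c = 1 ∧ c' = 1 := by
  have h0 := h k₀ le_rfl
  have h1 := h (k₀ + 1) (by lia)
  have h2 := h (k₀ + 2) (by lia)
  push_cast at h1 h2
  set t : ℤ := e + k₀ with ht
  have hk : (k₀ : ℤ) = t - e := by rw [ht]; ring
  rw [show e + ((k₀ : ℤ) + 1) = t + 1 by rw [ht]; ring, hk] at h1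
  rw [show e + ((k₀ : ℤ) + 2) = t + 2 by rw [ht]; ring, hk] at h2
  rw [hk] at h0
  -- In `t = e + k` the left side is `3e t² + (12e - 3e²) t + e³ - 6e² + 11e`. Differences of the
  -- three values give the coefficients in turn.
  have p2 : e = 2 * (a * b) := by linarith [h0, h1, h2]
  have p1 : 2 * (a * c' + b * c) = 4 * e - e ^ 2 := by
    have : 3 * (2 * (a * c' + b * c)) = 3 * (4 * e - e ^ 2) := by
      linear_combination h0 - h1 + 3 * (2 * t + 1) * p2
    lia
  have p0 : 6 * (c * c') = e ^ 3 - 6 * e ^ 2 + 11 * e := by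
    linear_combination -h0 + 3 * t ^ 2 * p2 - 3 * t * p1
  obtain ⟨m, hm⟩ : ∃ m, m = a * b := ⟨_, rfl⟩
  have hm1 : 1 ≤ m := by rw [hm]; nlinarith
  rw [← hm] at p2
  subst p2
  have hs : a * c' + b * c = 4 * m - 2 * m ^ 2 := by linarith
  have hm2 : 0 ≤ m ^ 2 * (4 - 4 * m ^ 2) := by
    -- The discriminant of `(a t + c)(b t + c')` is the square of `a c' - b c`, hence nonnegative;
    -- in terms of `m = a b` this forces `m ≤ 1`.
    have h3 : 3 * (a * c' - b * c) ^ 2 = m ^ 2 * (4 - 4 * m ^ 2) := by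
      have : 3 * (a * c' - b * c) ^ 2 = 3 * (a * c' + b * c) ^ 2 - 2 * m * (6 * (c * c')) := by
        rw [hm]; ring
      rw [this, hs, p0]
      ring
    rw [← h3]
    positivity
  have hm3 : m = 1 := by
    have : 0 ≤ 4 - 4 * m ^ 2 := nonneg_of_mul_nonneg_right hm2 (by positivity)
    nlinarith
  subst hm3
  have ha1 : a = 1 := by nlinarith
  subst ha1
  have hb1 : b = 1 := by lia
  subst hb1
  have hc : c + c' = 2 := by lia
  have hcc : (c - 1) ^ 2 = 0 := by
    have : c * c' = 1 := by lia
    have hc' : c' = 2 - c := by lia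
    rw [hc'] at this
    linear_combination -this
  have : c = 1 := by
    have := pow_eq_zero_iff (two_ne_zero) |>.1 hcc
    lia
  refine ⟨by lia, rfl, rfl, this, by lia⟩

/-! ### Ideals of hypersurfaces -/

namespace ProjSpace

variable {N : ℕ}

open TopologicalSpace

/-- An irreducible closed subset of `ℙ^N` containing a chain of length `N - 1` is everything or a
hypersurface. -/
theorem exists_coneIdeal_eq_span {p : LTSeries (IrreducibleCloseds (ProjSpace N))}
    (hp : N ≤ p.length + 1) (h0 : coneIdeal (p.last : Set (ProjSpace N)) ≠ ⊥) :
    ∃ (e : ℕ) (F : MvPolynomial (Fin (N + 1)) ℂ), F.IsHomogeneous e ∧ Irreducible F ∧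
      coneIdeal (p.last : Set (ProjSpace N)) = Ideal.span {F} := by
  have hprime := isPrime_coneIdeal p.last.isIrreducible
  obtain ⟨F, hFI, hF⟩ := hprime.exists_mem_prime_of_ne_bot h0
  have hspan : coneIdeal (p.last : Set (ProjSpace N)) = Ideal.span {F} := by
    -- If `(F)` were smaller than the cone ideal, then `(F)` and `0` would prolong the chain of
    -- primes to length `p.length + 3`, more than the dimension `N + 1` of the polynomial ring.
    by_contra hne
    obtain ⟨r, hr, hr'⟩ := exists_ltSeries_conePrime p
    let PF : PrimeSpectrum (MvPolynomial (Fin (N + 1)) ℂ) :=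
      ⟨Ideal.span {F}, (Ideal.span_singleton_prime hF.ne_zero).2 hF⟩
    have h1 : r.last < OrderDual.toDual PF := by
      rw [hr']
      refine OrderDual.toDual_lt_toDual.2 (lt_of_le_of_ne ?_ fun h => ?_)
      · exact (Ideal.span_singleton_le_iff_mem _).2 hFI
      · exact hne (congrArg PrimeSpectrum.asIdeal h).symm
    have h2 : (r.snoc _ h1).last < OrderDual.toDual ⊥ := by
      rw [RelSeries.last_snoc]
      refine OrderDual.toDual_lt_toDual.2 (bot_lt_iff_ne_bot.2 fun h => ?_)
      have := congrArg PrimeSpectrum.asIdeal h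
      exact hF.ne_zero (Ideal.span_singleton_eq_bot.1 this)
    have h3 := Order.LTSeries.length_le_krullDim ((r.snoc _ h1).snoc _ h2)
    rw [Order.krullDim_orderDual] at h3
    change _ ≤ ringKrullDim _ at h3
    rw [MvPolynomial.ringKrullDim_of_isNoetherianRing, ringKrullDim_eq_zero_of_field, zero_add,
      RelSeries.snoc_length, RelSeries.snoc_length, hr, Nat.card_eq_fintype_card,
      Fintype.card_fin] at h3
    have h4 : p.length + 1 + 1 + 1 ≤ N + 1 := by exact_mod_cast h3
    lia
  -- The ideal is graded, so `F` divides its own top component. The degrees agree, so the quotient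
  -- is a constant and `F` is a form.
  have hdvd : ∀ k, F ∣ homogeneousComponent k F := fun k => by
    rw [← Ideal.mem_span_singleton, ← hspan]
    exact homogeneousComponent_mem_coneIdeal hFI k
  refine ⟨F.totalDegree, F, ?_, hF.irreducible, hspan⟩
  obtain ⟨g, hg⟩ := hdvd F.totalDegree
  have hne : homogeneousComponent F.totalDegree F ≠ 0 := by
    obtain ⟨d, hd, hd'⟩ := Finset.exists_mem_eq_sup F.support (support_nonempty.2 hF.ne_zero)
      (fun d => d.sum fun _ e => e)
    intro h
    have h5 := congrArg (coeff d) h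
    rw [coeff_homogeneousComponent, if_pos, coeff_zero] at h5
    · exact mem_support_iff.1 hd h5
    · rw [totalDegree, hd']
      rfl
  have hg0 : g ≠ 0 := fun h => hne (by rw [hg, h, mul_zero])
  have hdeg := congrArg totalDegree hg
  rw [totalDegree_mul_of_isDomain hF.ne_zero hg0,
    (homogeneousComponent_isHomogeneous _ _).totalDegree hne] at hdeg
  have hg1 : g = C (coeff 0 g) := totalDegree_eq_zero_iff_eq_C.1 (by lia)
  have hc : coeff 0 g ≠ 0 := fun h => hg0 (by rw [hg1, h, C_0])
  have hF' : F = C (coeff 0 g)⁻¹ * homogeneousComponent F.totalDegree F := by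
    rw [hg, mul_comm F g]
    nth_rewrite 2 [hg1]
    rw [← mul_assoc, ← C_mul, inv_mul_cancel₀ hc, C_1, one_mul]
  rw [hF']
  nth_rewrite 2 [← hF']
  exact (homogeneousComponent_isHomogeneous _ _).C_mul _

end ProjSpace

/-! ### Where `p ⋆ q` is defined, and the conductor of the Hadamard map -/

namespace ProjSpace

variable {N : ℕ}

open TopologicalSpace

section Hadamard

variable {X Y : Set (ProjSpace N)}

theorem isClosed_hadamardProduct (X Y : Set (ProjSpace N)) : IsClosed (hadamardProduct X Y) :=
  isClosed_closure

theorem mk_mul_mem_hadamardProduct {x y : Fin (N + 1) → ℂ} (hx : x ∈ cone X) (hy : y ∈ cone Y)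
    (hxy : x * y ≠ 0) : mk (x * y) hxy ∈ hadamardProduct X Y := by
  have hx0 : x ≠ 0 := fun h => hxy (by rw [h, zero_mul])
  have hy0 : y ≠ 0 := fun h => hxy (by rw [h, mul_zero])
  have hdef := (hadamardDefined_mk_iff x y hx0 hy0).2 hxy
  refine subset_closure ⟨_, hx hx0, _, hy hy0, hdef, ?_⟩
  rw [hadamardPoint_mk x y hx0 hy0 hdef hxy]

theorem mul_mem_cone_hadamardProduct {x y : Fin (N + 1) → ℂ} (hx : x ∈ cone X) (hy : y ∈ cone Y) :
    x * y ∈ cone (hadamardProduct X Y) := fun h => mk_mul_mem_hadamardProduct hx hy h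

theorem hadamardProduct_subset {Z : Set (ProjSpace N)} (hZ : IsClosed Z)
    (h : ∀ x ∈ X, ∀ y ∈ Y, ∀ hxy : x.coords * y.coords ≠ 0, mk (x.coords * y.coords) hxy ∈ Z) :
    hadamardProduct X Y ⊆ Z := by
  refine closure_minimal ?_ hZ
  rintro _ ⟨x, hx, y, hy, hxy, rfl⟩
  exact h x hx y hy hxy

theorem coords_eq_zero_of_mem_hadamardProduct {i : Fin (N + 1)}
    (h : (∀ x ∈ X, x.coords i = 0) ∨ ∀ y ∈ Y, y.coords i = 0) {w : ProjSpace N}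
    (hw : w ∈ hadamardProduct X Y) : w.coords i = 0 := by
  refine hadamardProduct_subset (isClosed_setOf_coords_eq_zero i) (fun x hx y hy hxy => ?_) hw
  change (mk _ hxy).coords i = 0
  rw [coords_mk_eq_zero_iff, Pi.mul_apply]
  rcases h with h | h
  · rw [h x hx, zero_mul]
  · rw [h y hy, mul_zero]

/-- Identifies the image of `hadamardHom` with the coordinate ring of `X ⋆ Y`, so that its Hilbert
function can be computed on `X × Y`. -/
theorem hadamardHom_eq_zero_iff (hW : (hadamardProduct X Y).Nonempty)
    {f : MvPolynomial (Fin (N + 1)) ℂ} :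
    hadamardHom X Y f = 0 ↔ f ∈ coneIdeal (hadamardProduct X Y) := by
  constructor
  · intro h
    rw [← sum_homogeneousComponent f]
    refine Ideal.sum_mem _ fun k _ => ?_
    refine mem_coneIdeal_of_isHomogeneous hW (homogeneousComponent_isHomogeneous k f) fun w hw => ?_
    refine hadamardProduct_subset
      (isClosed_setOf_eval_eq_zero (homogeneousComponent_isHomogeneous k f))
      (fun x hx y hy hxy => ?_) hw
    refine (eval_coords_mk_eq_zero_iff (homogeneousComponent_isHomogeneous k f) _ hxy).2 ?_
    refine eval_homogeneousComponent_eq_zero (fun t => ?_) k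
    have := congrFun h (⟨t • x.coords, smul_mem_cone (coords_mem_cone.2 hx) t⟩,
      ⟨y.coords, coords_mem_cone.2 hy⟩)
    rwa [hadamardHom_apply, smul_mul_assoc] at this
  · intro h
    funext z
    exact mem_coneIdeal.1 h _ (mul_mem_cone_hadamardProduct z.1.2 z.2.2)

/-- A continuous extension of `z ↦ p ⋆ z` takes values supported in the support of `p`. -/
theorem coords_eq_zero_of_continuous {Z : Set (ProjSpace N)} (hZ : IsIrreducible Z)
    (hZ' : ∀ i, ∃ z ∈ Z, z.coords i ≠ 0) {p : ProjSpace N} {f : Z → ProjSpace N}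
    (hf : Continuous f) (hfp : ∀ z : Z, ∀ h : p.coords * z.1.coords ≠ 0, f z = mk _ h)
    {j : Fin (N + 1)} (hj : p.coords j = 0) (z : Z) : (f z).coords j = 0 := by
  have := (isIrreducible_iff_irreducibleSpace.1 hZ).isIrreducible_univ
  obtain ⟨i, hi⟩ : ∃ i, p.coords i ≠ 0 := Function.ne_iff.1 p.coords_ne_zero
  -- Where coordinate `i` of `z` is nonzero, `f z` is the product `p ⋆ z`, whose coordinate `j`
  -- vanishes. The remaining `z` form a proper closed subset of the irreducible `Z`.
  have hcov : (Set.univ : Set Z) ⊆ f ⁻¹' {p | p.coords j = 0} ∪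
      Subtype.val ⁻¹' {p : ProjSpace N | p.coords i = 0} := fun z _ => by
    by_cases hz : z.1.coords i = 0
    · exact Or.inr hz
    · have hpz : p.coords * z.1.coords ≠ 0 := fun h0 => mul_ne_zero hi hz (congrFun h0 i)
      refine Or.inl ?_
      change (f z).coords j = 0
      rw [hfp z hpz, coords_mk_eq_zero_iff, Pi.mul_apply, hj, zero_mul]
  rcases isPreirreducible_iff_isClosed_union_isClosed.1 this.isPreirreducible _ _
    ((isClosed_setOf_coords_eq_zero j).preimage hf)
    ((isClosed_setOf_coords_eq_zero i).preimage continuous_subtype_val) hcov with h | h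
  · exact h (Set.mem_univ z)
  · obtain ⟨z', hz', hi'⟩ := hZ' i
    exact absurd (h (Set.mem_univ ⟨z', hz'⟩)) hi'

theorem mk_congr {v w : Fin (N + 1) → ℂ} (h : v = w) (hv : v ≠ 0) (hw : w ≠ 0) :
    mk v hv = mk w hw := by subst h; rfl

/-- If `h` extends continuously and `X`, `Y` lie in no coordinate hyperplane then `p ⋆ q` is
defined everywhere. -/
theorem hadamardDefined_of_continuous {W : Set (ProjSpace N)} (hX : IsIrreducible X)
    (hY : IsIrreducible Y) (hX' : ∀ i, ∃ x ∈ X, x.coords i ≠ 0)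
    (hY' : ∀ i, ∃ y ∈ Y, y.coords i ≠ 0) (e : X × Y ≃ W)
    (he : ∀ (x : X) (y : Y) (h : HadamardDefined x.1 y.1),
      (e (x, y) : ProjSpace N) = hadamardPoint x.1 y.1 h)
    (h₁ : ∀ y, Continuous fun x => (e (x, y) : ProjSpace N))
    (h₂ : ∀ x, Continuous fun y => (e (x, y) : ProjSpace N)) (x : X) (y : Y) :
    HadamardDefined x.1 y.1 := by
  intro hxy
  -- If `p ⋆ q` is undefined, each `j` has `p j = 0` or `q j = 0`, and either one kills coordinate
  -- `j` of the extended map: an absurd point with all coordinates zero.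
  refine (e (x, y) : ProjSpace N).coords_ne_zero (funext fun j => ?_)
  rcases mul_eq_zero.1 (congrFun hxy j) with hj | hj
  · exact coords_eq_zero_of_continuous hY hY' (h₂ x) (fun z h => he x z h) hj y
  · exact coords_eq_zero_of_continuous hX hX' (h₁ y) (fun z h => (he z y (by
      rw [HadamardDefined, mul_comm]; exact h)).trans (mk_congr (mul_comm _ _) _ _)) hj x

theorem mul_eq_zero_of_forall_hadamardDefined
    (h : ∀ (x : X) (y : Y), HadamardDefined x.1 y.1) {x y : Fin (N + 1) → ℂ} (hx : x ∈ cone X)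
    (hy : y ∈ cone Y) (hxy : x * y = 0) : x = 0 ∨ y = 0 := by
  by_contra! hcon
  exact (hadamardDefined_mk_iff x y hcon.1 hcon.2).1 (h ⟨_, hx hcon.1⟩ ⟨_, hy hcon.2⟩) hxy

/-- Turns a local formula between points into an identity of vectors valid everywhere: where the
formula breaks down, `a = 0` serves. -/
theorem eval_eq_smul_of_mk_eq {n : ℕ} {G : Fin (N + 1) → MvPolynomial (Fin (N + 1)) ℂ}
    (hG : ∀ j, (G j).IsHomogeneous n) {v x : Fin (N + 1) → ℂ} (hv : v ≠ 0) (hx : x ≠ 0)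
    (h : ∀ hz : (fun j => eval (mk v hv).coords (G j)) ≠ 0, mk x hx = mk _ hz) :
    ∃ a : ℂ, ∀ j, eval v (G j) = a * x j := by
  obtain ⟨b, hb, hbv⟩ := exists_coords_mk v hv
  have hev : ∀ j, eval (mk v hv).coords (G j) = b ^ n * eval v (G j) := fun j => by
    rw [hbv, (hG j).eval_smul]
  by_cases hz : (fun j => eval (mk v hv).coords (G j)) = 0
  · refine ⟨0, fun j => ?_⟩
    have := congrFun hz j
    rw [hev, Pi.zero_apply, mul_eq_zero] at this
    rw [this.resolve_left (pow_ne_zero _ hb), zero_mul]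
  · obtain ⟨a, ha⟩ := (mk_eq_mk_iff hz hx).1 (h hz).symm
    refine ⟨(b ^ n)⁻¹ * a, fun j => ?_⟩
    have := congrFun ha j
    rw [Pi.smul_apply, smul_eq_mul, hev] at this
    rw [mul_assoc, this, inv_mul_cancel_left₀ (pow_ne_zero _ hb)]

/-- Regularity of the inverse of the Hadamard map, in terms of the homogeneous coordinate rings. -/
theorem exists_conductor (hdef : ∀ (x : X) (y : Y), HadamardDefined x.1 y.1)
    (e : X × Y ≃ hadamardProduct X Y)
    (he : ∀ (x : X) (y : Y) (h : HadamardDefined x.1 y.1),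
      (e (x, y) : ProjSpace N) = hadamardPoint x.1 y.1 h)
    (h₁ : IsRegular (hadamardProduct X Y) (fun w => ((e.symm w).1 : ProjSpace N)))
    (h₂ : IsRegular (hadamardProduct X Y) (fun w => ((e.symm w).2 : ProjSpace N)))
    {v : Fin (N + 1) → ℂ} (hv : v ≠ 0) :
    ∃ f : MvPolynomial (Fin (N + 1)) ℂ, eval v f ≠ 0 ∧
      ∀ i j, ∃ g, ∀ x ∈ cone X, ∀ y ∈ cone Y, eval (x * y) f * (x i * y j) = eval (x * y) g := by
  by_cases hvW : mk v hv ∈ hadamardProduct X Y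
  swap
  -- Away from `X ⋆ Y`, a form vanishing on it but not at `v` will do, with `g = 0`.
  · obtain ⟨n, F, hF, hFW, hFv⟩ :=
      exists_isHomogeneous_of_notMem (isClosed_hadamardProduct X Y) hvW
    refine ⟨F, fun h => hFv ((eval_coords_mk_eq_zero_iff hF v hv).2 h), fun i j => ⟨0, ?_⟩⟩
    intro x hx y hy
    rw [hFW _ (mul_mem_cone_hadamardProduct hx hy), zero_mul, map_zero]
  · obtain ⟨n, G, hG, hGv, hGe⟩ := h₁ ⟨_, hvW⟩
    obtain ⟨m, H, hH, hHv, hHe⟩ := h₂ ⟨_, hvW⟩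
    have hsymm : ∀ {x y : Fin (N + 1) → ℂ} (hx : x ∈ cone X) (hy : y ∈ cone Y) (hx0 : x ≠ 0)
        (hy0 : y ≠ 0) (hxy : x * y ≠ 0), e.symm ⟨_, mk_mul_mem_hadamardProduct hx hy hxy⟩ =
          (⟨mk x hx0, hx hx0⟩, ⟨mk y hy0, hy hy0⟩) := by
      intro x y hx hy hx0 hy0 hxy
      rw [Equiv.symm_apply_eq]
      refine Subtype.ext ?_
      have hd := (hadamardDefined_mk_iff x y hx0 hy0).2 hxy
      rw [he _ _ hd]
      exact (hadamardPoint_mk x y hx0 hy0 hd hxy).symm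
    have key : ∀ {x y : Fin (N + 1) → ℂ}, x ∈ cone X → y ∈ cone Y → x ≠ 0 → y ≠ 0 →
        (∃ a : ℂ, ∀ j, eval (x * y) (G j) = a * x j) ∧
          ∃ b : ℂ, ∀ j, eval (x * y) (H j) = b * y j := by
      intro x y hx hy hx0 hy0
      have hxy : x * y ≠ 0 := fun h =>
        (mul_eq_zero_of_forall_hadamardDefined hdef hx hy h).elim hx0 hy0
      have hs := hsymm hx hy hx0 hy0 hxy
      constructor
      · refine eval_eq_smul_of_mk_eq hG hxy hx0 fun hz => ?_
        exact (congrArg (fun z => (z.1 : ProjSpace N)) hs).symm.trans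
          (hGe ⟨_, mk_mul_mem_hadamardProduct hx hy hxy⟩ hz)
      · refine eval_eq_smul_of_mk_eq hH hxy hy0 fun hz => ?_
        exact (congrArg (fun z => (z.2 : ProjSpace N)) hs).symm.trans
          (hHe ⟨_, mk_mul_mem_hadamardProduct hx hy hxy⟩ hz)
    obtain ⟨k, hk⟩ : ∃ k, v k ≠ 0 := Function.ne_iff.1 hv
    -- At `x * y` the formulas give `G = a x` and `H = b y`, so `G k * H k * x i * y j` and `x k * y
    -- k * G i * H j` are both `a b` times `x k * y k * x i * y j`.
    refine ⟨G k * H k, ?_, fun i j => ⟨MvPolynomial.X k * G i * H j, fun x hx y hy => ?_⟩⟩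
    · obtain ⟨⟨x, y⟩, hxy⟩ := e.surjective ⟨_, hvW⟩
      have hxy' := congrArg Subtype.val hxy
      rw [he x y (hdef x y)] at hxy'
      obtain ⟨a, ha⟩ := (mk_eq_mk_iff (hdef x y) hv).1 hxy'
      have ha0 : a ≠ 0 := fun h => hdef x y (by rw [← ha, h, zero_smul])
      have hxyk : x.1.coords k * y.1.coords k ≠ 0 := by
        have := congrFun ha k
        rw [← Pi.mul_apply, ← this]
        exact mul_ne_zero ha0 hk
      obtain ⟨⟨b, hb⟩, ⟨c, hc⟩⟩ := key (coords_mem_cone.2 x.2) (coords_mem_cone.2 y.2)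
        x.1.coords_ne_zero y.1.coords_ne_zero
      -- Since `x k ≠ 0`, vanishing of `G k` would make the scalar zero and hence every `G j` zero
      -- at `v`.
      have hGk : eval v (G k) ≠ 0 := by
        intro h0
        refine hGv (funext fun j => (eval_coords_mk_eq_zero_iff (hG j) v hv).2 ?_)
        have h1 := hb k
        rw [← ha, (hG k).eval_smul, h0, mul_zero, eq_comm, mul_eq_zero] at h1
        have h2 := hb j
        rw [h1.resolve_right (left_ne_zero_of_mul hxyk), zero_mul, ← ha, (hG j).eval_smul,
          mul_eq_zero] at h2
        exact h2.resolve_left (pow_ne_zero _ ha0)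
      have hHk : eval v (H k) ≠ 0 := by
        intro h0
        refine hHv (funext fun j => (eval_coords_mk_eq_zero_iff (hH j) v hv).2 ?_)
        have h1 := hc k
        rw [← ha, (hH k).eval_smul, h0, mul_zero, eq_comm, mul_eq_zero] at h1
        have h2 := hc j
        rw [h1.resolve_right (right_ne_zero_of_mul hxyk), zero_mul, ← ha, (hH j).eval_smul,
          mul_eq_zero] at h2
        exact h2.resolve_left (pow_ne_zero _ ha0)
      rw [map_mul]
      exact mul_ne_zero hGk hHk
    · simp only [map_mul, eval_X, Pi.mul_apply]
      by_cases hx0 : x = 0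
      · simp [hx0]
      by_cases hy0 : y = 0
      · simp [hy0]
      obtain ⟨⟨a, ha⟩, ⟨b, hb⟩⟩ := key hx hy hx0 hy0
      rw [ha, hb, ha, hb]
      ring

end Hadamard

/-! ### Dimension counts -/

section Bounds

variable {X Y W : Set (ProjSpace N)}

theorem _root_.LTSeries.exists_last_eq {α : Type*} [PartialOrder α] (p : LTSeries α) {a : α}
    (h : p.last ≤ a) : ∃ q : LTSeries α, q.last = a ∧ p.length ≤ q.length := by
  rcases h.eq_or_lt with h | h
  · exact ⟨p, h, le_rfl⟩
  · exact ⟨p.snoc a h, RelSeries.last_snoc _ _ _, by rw [RelSeries.snoc_length]; lia⟩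

theorem nontrivial_of_one_le_dim {d : ℕ} (hd : 1 ≤ d) (h : dim X = d) : X.Nontrivial := by
  obtain ⟨p, hp⟩ := Order.le_krullDim_iff.1 (h.ge : (d : WithBot ℕ∞) ≤ dim X)
  have hlt := p.strictMono (show (⟨0, by lia⟩ : Fin (p.length + 1)) < ⟨1, by lia⟩ from
    Fin.mk_lt_mk.2 zero_lt_one)
  obtain ⟨x, hx⟩ := (p ⟨0, by lia⟩).isIrreducible.nonempty
  obtain ⟨y, hy, hyx⟩ := SetLike.exists_of_lt hlt
  exact ⟨x, x.2, y, y.2, fun hxy => hyx (by rwa [← Subtype.ext hxy])⟩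

theorem exists_dim_eq_of_hasCodim {c : ℕ} (h : HasCodim X c) : ∃ m : ℕ, dim X = m ∧ m + c = N := by
  unfold HasCodim at h
  generalize dim X = D at h ⊢
  induction D with
  | bot => simp at h
  | coe D =>
    induction D with
    | top => exact absurd h (by
        intro h
        have : ((⊤ : ℕ∞) + (c : ℕ∞) : ℕ∞) = (N : ℕ∞) := by exact_mod_cast h
        simp at this)
    | coe m => exact ⟨m, rfl, by exact_mod_cast h⟩

/-- Disjoint products of subvarieties have disjoint images, which bounds their dimensions. -/
theorem length_add_length_le_of_disjoint_prod (hW : IsClosed W) (e : X × Y ≃ W)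
    (h₁ : ∀ y, Continuous fun x => (e (x, y) : ProjSpace N))
    (h₂ : ∀ x, Continuous fun y => (e (x, y) : ProjSpace N))
    (h₃ : Continuous fun w => ((e.symm w).1 : ProjSpace N))
    (h₄ : Continuous fun w => ((e.symm w).2 : ProjSpace N)) {J : Finset (Fin (N + 1))}
    (hJ : ∀ w ∈ W, ∀ i ∉ J, coords w i = 0) {p p' : LTSeries (IrreducibleCloseds X)}
    {q q' : LTSeries (IrreducibleCloseds Y)}
    (h : ∀ x y, x ∈ p.last → x ∈ p'.last → y ∈ q.last → y ∈ q'.last → False) :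
    p.length + q.length + (p'.length + q'.length) + 2 ≤ J.card := by
  obtain ⟨r, hr, hr'⟩ := exists_ltSeries_prodImage hW e h₁ h₂ h₃ h₄ p q
  obtain ⟨s, hs, hs'⟩ := exists_ltSeries_prodImage hW e h₁ h₂ h₃ h₄ p' q'
  have hmem : ∀ A B, ∀ w ∈ prodImage hW e h₁ h₂ h₃ h₄ A B, w ∈ W := by
    rintro A B _ ⟨x, -, y, -, rfl⟩
    exact (e (x, y)).2
  have := length_add_length_le_of_disjoint (p := r) (q := s) (by
      rw [hr', hs', Set.disjoint_left]
      rintro _ ⟨x, hx, y, hy, rfl⟩ hw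
      obtain ⟨hx', hy'⟩ := (apply_mem_prodImage hW e h₁ h₂ h₃ h₄).1 hw
      exact h x y hx hx' hy hy') J
    (fun x hx => hJ x (hmem _ _ _ (hr' ▸ hx))) (fun x hx => hJ x (hmem _ _ _ (hs' ▸ hx)))
  rwa [hr, hs] at this

end Bounds

end ProjSpace

/-! ### An isomorphism forces two lines and a quadric -/

namespace ProjSpace

variable {N : ℕ}

open TopologicalSpace

/-- If the Hadamard map is an isomorphism then the dimensions are those of curves in `ℙ³` and
`p ⋆ q` is defined everywhere. -/
theorem HadamardMapIsIso.eq_three {d m : ℕ} {X Y : Set (ProjSpace N)} (hd : 1 ≤ d)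
    (hdm : d + m + 1 = N) (hdN : 2 * d < N) (hX : IsVariety X) (hY : IsVariety Y)
    (hXd : dim X = d) (hYd : dim Y = m) {e : X × Y ≃ hadamardProduct X Y}
    (he : ∀ (x : X) (y : Y) (h : HadamardDefined x.1 y.1),
      (e (x, y) : ProjSpace N) = hadamardPoint x.1 y.1 h)
    (h₁ : ∀ y, Continuous fun x => (e (x, y) : ProjSpace N))
    (h₂ : ∀ x, Continuous fun y => (e (x, y) : ProjSpace N))
    (h₃ : Continuous fun w => ((e.symm w).1 : ProjSpace N))
    (h₄ : Continuous fun w => ((e.symm w).2 : ProjSpace N)) :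
    N = 3 ∧ ∀ (x : X) (y : Y), HadamardDefined x.1 y.1 := by
  have hW := isClosed_hadamardProduct X Y
  obtain ⟨p, hp⟩ := Order.le_krullDim_iff.1 (hXd.ge : (d : WithBot ℕ∞) ≤ dim X)
  obtain ⟨q, hq⟩ := Order.le_krullDim_iff.1 (hYd.ge : (m : WithBot ℕ∞) ≤ dim Y)
  obtain ⟨x₁, hx₁, x₂, hx₂, hne⟩ := nontrivial_of_one_le_dim hd hXd
  -- The disjoint slices are `{x₁} × Y` and `{x₂} × Y`, each of dimension `m`.
  have hslices : ∀ J : Finset (Fin (N + 1)),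
      (∀ w ∈ hadamardProduct X Y, ∀ i ∉ J, coords w i = 0) → 2 * m + 2 ≤ J.card := fun J hJ => by
    have := length_add_length_le_of_disjoint_prod hW e h₁ h₂ h₃ h₄ hJ
      (p := RelSeries.singleton _ {⟨x₁, hx₁⟩}) (p' := RelSeries.singleton _ {⟨x₂, hx₂⟩})
      (q := q) (q' := q) (fun x y hx hx' _ _ => hne (congrArg Subtype.val
        ((IrreducibleCloseds.mem_singleton.1 hx).symm.trans
          (IrreducibleCloseds.mem_singleton.1 hx'))))
    rw [RelSeries.singleton_length, RelSeries.singleton_length, hq] at this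
    lia
  -- Inside a coordinate hyperplane only `N` coordinates remain, and `2m + 2 ≤ N` contradicts `2d <
  -- N`.
  have hcoord : ∀ i, ¬ ((∀ x ∈ X, coords x i = 0) ∨ ∀ y ∈ Y, coords y i = 0) := fun i hi => by
    have := hslices (Finset.univ.erase i) fun w hw j hj => by
      have hji : j = i := by simpa using hj
      rw [hji]
      exact coords_eq_zero_of_mem_hadamardProduct hi hw
    rw [Finset.card_erase_of_mem (Finset.mem_univ i), Finset.card_fin] at this
    lia
  have hN := hslices Finset.univ (by simp)
  rw [Finset.card_fin] at hN
  have hq0 : q.length ≠ 0 := by lia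
  have hlt : q.eraseLast.last < q.last := RelSeries.eraseLast_last_rel_last q hq0
  obtain ⟨y, hy, hyB⟩ := SetLike.exists_of_lt hlt
  -- Here `X × {y}` meets `X × B`, where `B = q.eraseLast.last` omits `y`, in nothing. The bound
  -- reads `2d + m ≤ N`, hence `d ≤ 1`; the first count gives `m = d`.
  have hsecond := length_add_length_le_of_disjoint_prod hW e h₁ h₂ h₃ h₄ (J := Finset.univ)
    (by simp) (p := p) (p' := p) (q := RelSeries.singleton _ {y}) (q' := q.eraseLast)
    (fun _ z _ _ hz hz' => hyB (by rwa [← IrreducibleCloseds.mem_singleton.1 hz]))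
  rw [RelSeries.singleton_length, RelSeries.eraseLast_length, hp, hq, Finset.card_fin] at hsecond
  refine ⟨by lia, hadamardDefined_of_continuous hX.isIrreducible hY.isIrreducible
    (fun i => ?_) (fun i => ?_) e he h₁ h₂⟩
  · by_contra! h
    exact hcoord i (Or.inl h)
  · by_contra! h
    exact hcoord i (Or.inr h)

/-- An everywhere defined Hadamard isomorphism of curves in `ℙ³` is one of lines, onto a
quadric. -/
theorem isLine_and_isQuadric {X Y : Set (ProjSpace 3)} (hX : IsVariety X) (hY : IsVariety Y)
    (hXd : dim X = 1) (hYd : dim Y = 1) {e : X × Y ≃ hadamardProduct X Y}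
    (hdef : ∀ (x : X) (y : Y), HadamardDefined x.1 y.1)
    (he : ∀ (x : X) (y : Y) (h : HadamardDefined x.1 y.1),
      (e (x, y) : ProjSpace 3) = hadamardPoint x.1 y.1 h)
    (h₁ : ∀ y, Continuous fun x => (e (x, y) : ProjSpace 3))
    (h₂ : ∀ x, Continuous fun y => (e (x, y) : ProjSpace 3))
    (h₃ : IsRegular (hadamardProduct X Y) (fun w => ((e.symm w).1 : ProjSpace 3)))
    (h₄ : IsRegular (hadamardProduct X Y) (fun w => ((e.symm w).2 : ProjSpace 3))) :
    IsLine X ∧ IsLine Y ∧ IsQuadric (hadamardProduct X Y) := by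
  have hW := isClosed_hadamardProduct X Y
  have hXnt : X.Nontrivial := nontrivial_of_one_le_dim le_rfl (by exact_mod_cast hXd)
  have hYnt : Y.Nontrivial := nontrivial_of_one_le_dim le_rfl (by exact_mod_cast hYd)
  have hWne : (hadamardProduct X Y).Nonempty := by
    obtain ⟨x, hx⟩ := hXnt.nonempty
    obtain ⟨y, hy⟩ := hYnt.nonempty
    exact ⟨_, (e (⟨x, hx⟩, ⟨y, hy⟩)).2⟩
  obtain ⟨k₁, hk₁⟩ := exists_finrank_hadamard_eq hX.isClosed hY.isClosed
    (fun x hx y hy => mul_eq_zero_of_forall_hadamardDefined hdef hx hy)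
    (fun v hv => exists_conductor hdef e he h₃ h₄ hv)
  obtain ⟨a, c, ha, k₂, hk₂⟩ := exists_hilbertFunction_eq hX hXd hXnt
  obtain ⟨b, c', hb, k₃, hk₃⟩ := exists_hilbertFunction_eq hY hYd hYnt
  have hker : ∀ f, hadamardHom X Y f = 0 ↔ f ∈ coneIdeal (hadamardProduct X Y) := fun f =>
    hadamardHom_eq_zero_iff hWne
  -- If `X ⋆ Y` were all of `ℙ³`, its Hilbert function would be cubic.
  have hne : coneIdeal (hadamardProduct X Y) ≠ ⊥ := fun hbot => by
    refine not_eventually_cubic_eq (a := a) (b := b) (c := c) (c' := c') (k₀ := k₁ + k₂ + k₃)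
      fun k hk => ?_
    have h := finrank_linearPart_pow_of_injective (hadamardHom X Y)
      (fun f hf => by rwa [hker, hbot, Ideal.mem_bot] at hf) k
    rw [hk₁ k (by lia)] at h
    rw [← hk₂ k (by lia), ← hk₃ k (by lia), ← six_mul_finrank_homogeneousSubmodule_four, ← h]
    push_cast
    ring
  obtain ⟨p, hp⟩ := Order.le_krullDim_iff.1 (hXd.ge : ((1 : ℕ) : WithBot ℕ∞) ≤ dim X)
  obtain ⟨q, hq⟩ := Order.le_krullDim_iff.1 (hYd.ge : ((1 : ℕ) : WithBot ℕ∞) ≤ dim Y)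
  obtain ⟨r, hr, hr'⟩ := exists_ltSeries_prodImage hW e h₁ h₂ h₃.continuous h₄.continuous p q
  have := isIrreducible_iff_irreducibleSpace.1 hX.isIrreducible
  have := isIrreducible_iff_irreducibleSpace.1 hY.isIrreducible
  let W : IrreducibleCloseds (ProjSpace 3) :=
    prodImage hW e h₁ h₂ h₃.continuous h₄.continuous
      ⟨Set.univ, IrreducibleSpace.isIrreducible_univ X, isClosed_univ⟩
      ⟨Set.univ, IrreducibleSpace.isIrreducible_univ Y, isClosed_univ⟩
  have hWeq : (W : Set (ProjSpace 3)) = hadamardProduct X Y := by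
    ext w
    constructor
    · rintro ⟨x, -, y, -, rfl⟩
      exact (e (x, y)).2
    · intro hw
      exact ⟨_, Set.mem_univ (e.symm ⟨w, hw⟩).1, _, Set.mem_univ (e.symm ⟨w, hw⟩).2, by simp⟩
  -- A chain of length at least `2` ending at `X ⋆ Y` is what `exists_coneIdeal_eq_span` needs for
  -- `N = 3`.
  obtain ⟨s, hs, hs'⟩ := r.exists_last_eq (a := W) (by
    rw [hr']
    rintro _ ⟨x, -, y, -, rfl⟩
    exact ⟨x, Set.mem_univ x, y, Set.mem_univ y, rfl⟩)
  rw [← hWeq, ← hs] at hne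
  obtain ⟨e', F, hF, hirr, hspan⟩ := exists_coneIdeal_eq_span (p := s) (by lia) hne
  rw [hs, hWeq] at hspan
  have hnum := eq_one_of_hilbert_eq (a := a) (b := b) (c := c) (c' := c') (e := e')
    (k₀ := k₁ + k₂ + k₃) ha hb fun k hk => by
      have h := finrank_linearPart_pow_add (hadamardHom X Y) hF hirr.ne_zero
        (fun f => by rw [hker, hspan, Ideal.mem_span_singleton]) k
      rw [hk₁ _ (by lia)] at h
      have e1 := hk₂ (e' + k) (by lia)
      have e2 := hk₃ (e' + k) (by lia)
      have e3 := six_mul_finrank_homogeneousSubmodule_four (e' + k)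
      have e4 := six_mul_finrank_homogeneousSubmodule_four k
      push_cast at e1 e2 e3
      rw [← e1, ← e2, ← e3, ← e4, ← h]
      push_cast
      ring
  obtain ⟨he', rfl, rfl, rfl, rfl⟩ := hnum
  have he2 : e' = 2 := by exact_mod_cast he'
  subst he2
  refine ⟨isLine_of_hilbertFunction hX hXnt (k₀ := k₂) fun k hk => ?_,
    isLine_of_hilbertFunction hY hYnt (k₀ := k₃) fun k hk => ?_, F, hF, hirr, ?_⟩
  · have := hk₂ k hk
    lia
  · have := hk₃ k hk
    lia
  · ext w
    rw [← coords_mem_cone, mem_cone_iff_forall_eval hW]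
    constructor
    · rintro h _ rfl
      exact h _ (mem_coneIdeal.1 (hspan ▸ Ideal.mem_span_singleton_self _))
    · intro h f hf
      obtain ⟨g, rfl⟩ := Ideal.mem_span_singleton.1 (hspan ▸ mem_coneIdeal.2 hf)
      rw [map_mul, h F rfl, zero_mul]

theorem HadamardMapIsIso.isLine_and_isQuadric {d : ℕ} {X Y : Set (ProjSpace N)} (hd : 1 ≤ d)
    (hdN : 2 * d < N) (hX : IsVariety X) (hY : IsVariety Y) (hXd : dim X = d)
    (hYd : HasCodim Y (d + 1)) (h : HadamardMapIsIso X Y) :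
    N = 3 ∧ IsLine X ∧ IsLine Y ∧ IsQuadric (hadamardProduct X Y) := by
  obtain ⟨e, he, hreg, h₃, h₄⟩ := h
  have h₁ := fun y => hreg.continuous_left y
  have h₂ := fun x => hreg.continuous_right x
  obtain ⟨m, hm, hmN⟩ := exists_dim_eq_of_hasCodim hYd
  obtain ⟨hN, hdef⟩ := HadamardMapIsIso.eq_three hd (by lia) hdN hX hY hXd hm he h₁ h₂
    h₃.continuous h₄.continuous
  subst hN
  have hd1 : d = 1 := by lia
  have hm1 : m = 1 := by lia
  subst hd1 hm1
  exact ⟨rfl, ProjSpace.isLine_and_isQuadric hX hY (by exact_mod_cast hXd) (by exact_mod_cast hm)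
    hdef he h₁ h₂ h₃ h₄⟩

end ProjSpace

/-! ### The converse: lines whose product is a quadric -/

theorem LinearMap.eval_linearForm_apply_single {n : ℕ} (f : (Fin n → ℂ) →ₗ[ℂ] ℂ)
    (v : Fin n → ℂ) : eval v (linearForm fun i => f (Pi.single i 1)) = f v := by
  rw [eval_linearForm]
  conv_rhs => rw [← LinearMap.sum_single_apply (fun _ => ℂ) v, map_sum]
  refine Finset.sum_congr rfl fun i _ => ?_
  have h : Pi.single i (v i) = v i • (Pi.single i 1 : Fin n → ℂ) := by
    rw [← Pi.single_smul, smul_eq_mul, mul_one]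
  change _ = f (Pi.single i (v i))
  rw [h, map_smul, smul_eq_mul, mul_comm]

/-- A `2 × 2` matrix with zero determinant has rank at most one. -/
theorem exists_mul_eq_of_mul_eq_mul {K : Type*} [Field K] {m : Fin 2 → Fin 2 → K}
    (h : m 0 0 * m 1 1 = m 0 1 * m 1 0) : ∃ s t : Fin 2 → K, ∀ i j, m i j = s i * t j := by
  by_cases h₀ : m 0 0 = 0
  · rw [h₀, zero_mul, eq_comm, mul_eq_zero] at h
    rcases h with h | h
    · exact ⟨![0, 1], m 1, by simp [Fin.forall_fin_two, h₀, h]⟩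
    · exact ⟨fun i => m i 1, ![0, 1], by simp [Fin.forall_fin_two, h₀, h]⟩
  · refine ⟨![1, m 1 0 / m 0 0], m 0, ?_⟩
    simp only [Fin.forall_fin_two, Matrix.cons_val_zero, Matrix.cons_val_one, one_mul, true_and]
    field_simp
    exact ⟨trivial, h.trans (mul_comm _ _)⟩

namespace ProjSpace

variable {N M : ℕ}

theorem IsLine.exists_cone_eq {X : Set (ProjSpace N)} (hX : IsLine X) :
    ∃ a : Fin 2 → Fin (N + 1) → ℂ, ∀ v, v ∈ cone X ↔ ∃ s : Fin 2 → ℂ, v = ∑ i, s i • a i := by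
  obtain ⟨E, hE, rfl⟩ := hX
  have : FiniteDimensional ℂ E := .of_finrank_pos (by lia)
  have b := Module.finBasisOfFinrankEq ℂ E hE
  refine ⟨fun i => b i, fun v => ?_⟩
  have hv : v ∈ cone {p : ProjSpace N | p.coords ∈ E} ↔ v ∈ E := by
    by_cases hv : v = 0
    · simp [hv, zero_mem_cone]
    · obtain ⟨t, ht, h⟩ := exists_coords_mk v hv
      rw [mem_cone_iff hv, Set.mem_ofPred_eq, h, E.smul_mem_iff ht]
  rw [hv]
  constructor
  · intro h
    refine ⟨b.repr ⟨v, h⟩, ?_⟩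
    have := congrArg E.subtype (b.sum_repr ⟨v, h⟩)
    rw [map_sum] at this
    exact this.symm
  · rintro ⟨s, rfl⟩
    exact E.sum_mem fun i _ => E.smul_mem _ (b i).2

/-- A quadric is not contained in a hyperplane. -/
theorem IsQuadric.eq_zero_of_forall_dotProduct {W : Set (ProjSpace N)} (hW : IsQuadric W)
    {c : Fin (N + 1) → ℂ} (h : ∀ p ∈ W, c ⬝ᵥ p.coords = 0) : c = 0 := by
  obtain ⟨F, hF, hirr, rfl⟩ := hW
  have hprime : (Ideal.span {F}).IsPrime :=
    (Ideal.span_singleton_prime hirr.ne_zero).2 hirr.prime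
  have hmem : linearForm c ∈ Ideal.span {F} := by
    rw [← hprime.radical, ← vanishingIdeal_zeroLocus_eq_radical (K := ℂ), mem_vanishingIdeal_iff]
    intro v hv
    rw [aeval_eq_eval]
    change eval v _ = 0
    rw [eval_linearForm]
    have hvF : eval v F = 0 := by
      simpa [aeval_eq_eval] using hv F (Ideal.mem_span_singleton_self F)
    by_cases hv0 : v = 0
    · rw [hv0, dotProduct_zero]
    · obtain ⟨t, ht, e⟩ := exists_coords_mk v hv0
      have := h (mk v hv0) (by
        rintro _ rfl
        exact (eval_coords_mk_eq_zero_iff hF v hv0).2 hvF)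
      rw [e, dotProduct_smul, smul_eq_mul] at this
      exact (mul_eq_zero.1 this).resolve_left ht
  -- A nonzero form of degree one is not divisible by one of degree two.
  have h0 : linearForm c = 0 := by
    by_contra hne
    obtain ⟨G, hG⟩ := Ideal.mem_span_singleton.1 hmem
    have hG0 : G ≠ 0 := by
      rintro rfl
      exact hne (by rw [hG, mul_zero])
    have := congrArg totalDegree hG
    rw [(isHomogeneous_linearForm c).totalDegree hne,
      totalDegree_mul_of_isDomain hirr.ne_zero hG0, hF.totalDegree hirr.ne_zero] at this
    lia
  refine funext fun i => ?_
  have := eval_linearForm c (Pi.single i 1)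
  rw [h0, map_zero, dotProduct_single_one] at this
  exact this.symm

theorem mk_eq_of_eq_smul {v : Fin (N + 1) → ℂ} (hv : v ≠ 0) {p : ProjSpace N} {t : ℂ}
    (h : v = t • p.coords) : mk v hv = p := by
  rw [← p.mk_coords]
  exact (mk_eq_mk_iff _ _).2 ⟨t, h.symm⟩

/-- A map which is given, up to scalars, by linear maps without common zeros is regular. -/
theorem isRegular_of_linear {ι : Type*} {X : Set (ProjSpace N)} {f : X → ProjSpace M}
    (L : ι → (Fin (N + 1) → ℂ) →ₗ[ℂ] (Fin (M + 1) → ℂ))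
    (hL : ∀ x : X, ∃ u : ι → ℂ, u ≠ 0 ∧ ∀ i, L i x.1.coords = u i • (f x).coords) :
    IsRegular X f := by
  intro x
  obtain ⟨u, hu, h⟩ := hL x
  obtain ⟨i, hi⟩ := Function.ne_iff.1 hu
  obtain ⟨G, hG, heval⟩ : ∃ G : Fin (M + 1) → MvPolynomial (Fin (N + 1)) ℂ,
      (∀ j, (G j).IsHomogeneous 1) ∧ ∀ v, (fun j => eval v (G j)) = L i v :=
    ⟨fun j => linearForm fun k => (LinearMap.proj j ∘ₗ L i) (Pi.single k 1),
      fun j => isHomogeneous_linearForm _,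
      fun v => funext fun j => LinearMap.eval_linearForm_apply_single _ v⟩
  refine ⟨1, G, hG, ?_, fun z hz => ?_⟩
  · rw [heval, h]
    exact smul_ne_zero hi (coords_ne_zero _)
  · obtain ⟨u', -, h'⟩ := hL z
    exact (mk_eq_of_eq_smul hz ((heval _).trans (h' i))).symm

theorem isBihomogeneous_X_inl_mul_X_inr (j : Fin (N + 1)) :
    IsBihomogeneous (X (Sum.inl j) * X (Sum.inr j)) 1 1 :=
  (isWeightedHomogeneous_X ℂ _ (Sum.inl j)).mul (isWeightedHomogeneous_X ℂ _ (Sum.inr j))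

/-- The Hadamard map of two lines whose product spans `ℙ³` is an isomorphism. -/
theorem hadamardMapIsIso_of_basis {X Y : Set (ProjSpace 3)} {a c : Fin 2 → Fin 4 → ℂ}
    (hX : ∀ v, v ∈ cone X ↔ ∃ s : Fin 2 → ℂ, v = ∑ i, s i • a i)
    (hY : ∀ v, v ∈ cone Y ↔ ∃ s : Fin 2 → ℂ, v = ∑ i, s i • c i)
    (B : Module.Basis (Fin 2 × Fin 2) ℂ (Fin 4 → ℂ)) (hB : ∀ i j, B (i, j) = a i * c j) :
    HadamardMapIsIso X Y := by
  have hmul : ∀ s t : Fin 2 → ℂ, (∑ i, s i • a i) * ∑ j, t j • c j =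
      ∑ z : Fin 2 × Fin 2, (s z.1 * t z.2) • B z := fun s t => by
    rw [Finset.sum_mul_sum, Fintype.sum_prod_type]
    simp only [hB, smul_mul_smul_comm]
  have hrepr : ∀ s t : Fin 2 → ℂ, ∀ i j,
      B.repr ((∑ i, s i • a i) * ∑ j, t j • c j) (i, j) = s i * t j := fun s t i j => by
    rw [hmul, B.repr_sum_self]
  -- In the basis `B` the product `x * y` is the matrix `s i * t j`. Its column `j` is `t j • s` and
  -- its row `i` is `s i • t`, so `P j` and `Q i` recover `x` and `y` up to a scalar.
  let P : Fin 2 → (Fin 4 → ℂ) →ₗ[ℂ] (Fin 4 → ℂ) :=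
    fun j => ∑ i, (B.coord (i, j)).smulRight (a i)
  let Q : Fin 2 → (Fin 4 → ℂ) →ₗ[ℂ] (Fin 4 → ℂ) :=
    fun i => ∑ j, (B.coord (i, j)).smulRight (c j)
  have hP : ∀ (s t : Fin 2 → ℂ) j,
      P j ((∑ i, s i • a i) * ∑ j, t j • c j) = t j • ∑ i, s i • a i := fun s t j => by
    simp only [P, LinearMap.sum_apply, LinearMap.smulRight_apply, B.coord_apply, hrepr,
      Finset.smul_sum, smul_smul, mul_comm (t j)]
  have hQ : ∀ (s t : Fin 2 → ℂ) i,
      Q i ((∑ i, s i • a i) * ∑ j, t j • c j) = s i • ∑ j, t j • c j := fun s t i => by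
    simp only [Q, LinearMap.sum_apply, LinearMap.smulRight_apply, B.coord_apply, hrepr,
      Finset.smul_sum, smul_smul]
  have hdef : ∀ (x : X) (y : Y), HadamardDefined x.1 y.1 := fun x y h => by
    obtain ⟨s, hs⟩ := (hX _).1 (coords_mem_cone.2 x.2)
    obtain ⟨t, ht⟩ := (hY _).1 (coords_mem_cone.2 y.2)
    obtain ⟨i, hi⟩ : ∃ i, s i ≠ 0 := by
      by_contra! h0
      exact coords_ne_zero _ (hs.trans (by simp [h0]))
    obtain ⟨j, hj⟩ : ∃ j, t j ≠ 0 := by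
      by_contra! h0
      exact coords_ne_zero _ (ht.trans (by simp [h0]))
    have := hrepr s t i j
    rw [← hs, ← ht, h, map_zero, Finsupp.zero_apply] at this
    exact mul_ne_zero hi hj this.symm
  let m : X × Y → hadamardProduct X Y := fun z => ⟨hadamardPoint z.1.1 z.2.1 (hdef z.1 z.2),
    subset_closure ⟨_, z.1.2, _, z.2.2, hdef z.1 z.2, rfl⟩⟩
  have hm : ∀ z, (∃ u : Fin 2 → ℂ, u ≠ 0 ∧ ∀ j, P j (m z).1.coords = u j • z.1.1.coords) ∧
      ∃ u : Fin 2 → ℂ, u ≠ 0 ∧ ∀ i, Q i (m z).1.coords = u i • z.2.1.coords := by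
    intro z
    obtain ⟨s, hs⟩ := (hX _).1 (coords_mem_cone.2 z.1.2)
    obtain ⟨t, ht⟩ := (hY _).1 (coords_mem_cone.2 z.2.2)
    obtain ⟨k, hk, h⟩ := exists_coords_mk _ (hdef z.1 z.2)
    refine ⟨⟨k • t, smul_ne_zero hk ?_, fun j => ?_⟩, ⟨k • s, smul_ne_zero hk ?_, fun i => ?_⟩⟩
    · rintro rfl
      exact coords_ne_zero _ (ht.trans (by simp))
    · change P j (mk _ _).coords = _
      rw [h, map_smul, hs, ht, hP, smul_smul, Pi.smul_apply, smul_eq_mul]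
    · rintro rfl
      exact coords_ne_zero _ (hs.trans (by simp))
    · change Q i (mk _ _).coords = _
      rw [h, map_smul, hs, ht, hQ, smul_smul, Pi.smul_apply, smul_eq_mul]
  have hunique : ∀ {v : Fin 2 → Fin 4 → ℂ} {p q : ProjSpace 3},
      (∃ u : Fin 2 → ℂ, u ≠ 0 ∧ ∀ j, v j = u j • p.coords) →
      (∃ u : Fin 2 → ℂ, u ≠ 0 ∧ ∀ j, v j = u j • q.coords) → p = q := by
    rintro v p q ⟨u, hu, h⟩ ⟨u', -, h'⟩
    obtain ⟨j, hj⟩ := Function.ne_iff.1 hu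
    have hv : v j ≠ 0 := by
      rw [h]
      exact smul_ne_zero hj p.coords_ne_zero
    rw [← mk_eq_of_eq_smul hv (h j), mk_eq_of_eq_smul hv (h' j)]
  have hinj : Function.Injective m := fun z z' h =>
    Prod.ext (Subtype.ext (hunique (hm z).1 (h ▸ (hm z').1)))
      (Subtype.ext (hunique (hm z).2 (h ▸ (hm z').2)))
  -- The determinant vanishes on the products, hence on their closure. So every point of `X ⋆ Y` is
  -- a matrix of rank one, that is, an actual product.
  have hdet : ∀ w ∈ hadamardProduct X Y, B.repr w.coords (0, 0) * B.repr w.coords (1, 1) =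
      B.repr w.coords (0, 1) * B.repr w.coords (1, 0) := by
    let φ : Fin 2 × Fin 2 → MvPolynomial (Fin 4) ℂ :=
      fun z => linearForm fun i => B.coord z (Pi.single i 1)
    have hφ : ∀ z v, eval v (φ z) = B.repr v z :=
      fun z v => (B.coord z).eval_linearForm_apply_single v
    have hφ' : ∀ z, (φ z).IsHomogeneous 1 := fun z => isHomogeneous_linearForm _
    have hΔ : (φ (0, 0) * φ (1, 1) - φ (0, 1) * φ (1, 0)).IsHomogeneous 2 :=
      ((hφ' _).mul (hφ' _)).sub ((hφ' _).mul (hφ' _))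
    intro w hw
    have := hadamardProduct_subset (isClosed_setOf_eval_eq_zero hΔ) (fun x hx y hy hxy => by
      obtain ⟨s, hs⟩ := (hX _).1 (coords_mem_cone.2 hx)
      obtain ⟨t, ht⟩ := (hY _).1 (coords_mem_cone.2 hy)
      refine (eval_coords_mk_eq_zero_iff hΔ _ hxy).2 ?_
      rw [map_sub, map_mul, map_mul, hφ, hφ, hφ, hφ, hs, ht, hrepr, hrepr, hrepr, hrepr]
      ring) hw
    simpa [hφ, sub_eq_zero] using this
  have hsurj : Function.Surjective m := fun w => by
    obtain ⟨s, t, hst⟩ := exists_mul_eq_of_mul_eq_mul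
      (m := fun i j => B.repr w.1.coords (i, j)) (hdet w w.2)
    have hw : (∑ i, s i • a i) * ∑ j, t j • c j = w.1.coords := by
      rw [hmul]
      conv_rhs => rw [← B.sum_repr w.1.coords]
      exact Finset.sum_congr rfl fun z _ => by rw [← hst]
    have hw0 := hw ▸ w.1.coords_ne_zero
    have hx := left_ne_zero_of_mul hw0
    have hy := right_ne_zero_of_mul hw0
    refine ⟨(⟨mk _ hx, (mem_cone_iff hx).1 ((hX _).2 ⟨s, rfl⟩)⟩,
      ⟨mk _ hy, (mem_cone_iff hy).1 ((hY _).2 ⟨t, rfl⟩)⟩), Subtype.ext ?_⟩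
    change hadamardPoint _ _ _ = _
    rw [hadamardPoint_mk _ _ hx hy _ hw0]
    exact mk_eq_of_eq_smul hw0 (t := 1) (by rw [hw, one_smul])
  let e := Equiv.ofBijective m ⟨hinj, hsurj⟩
  refine ⟨e, fun x y h => rfl, fun z => ⟨1, 1, fun j => MvPolynomial.X (Sum.inl j) *
    MvPolynomial.X (Sum.inr j), isBihomogeneous_X_inl_mul_X_inr, ?_, fun z hz => ?_⟩,
    isRegular_of_linear P fun w => ?_, isRegular_of_linear Q fun w => ?_⟩
  · simp only [map_mul, eval_X]
    exact hdef z.1 z.2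
  · exact (mk_eq_mk_iff _ _).2 ⟨1, by ext; simp⟩
  · have := (hm (e.symm w)).1
    rwa [show m (e.symm w) = w from e.apply_symm_apply w] at this
  · have := (hm (e.symm w)).2
    rwa [show m (e.symm w) = w from e.apply_symm_apply w] at this

/-- A linear form which kills all four products `a i * c j` vanishes on `X ⋆ Y`. A quadric lies in
no hyperplane, so these products span `ℂ⁴` and form a basis. -/
theorem hadamardMapIsIso_of_isLine {X Y : Set (ProjSpace 3)} (hX : IsLine X) (hY : IsLine Y)
    (hW : IsQuadric (hadamardProduct X Y)) : HadamardMapIsIso X Y := by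
  obtain ⟨a, ha⟩ := hX.exists_cone_eq
  obtain ⟨c, hc⟩ := hY.exists_cone_eq
  let b : Fin 2 × Fin 2 → Fin 4 → ℂ := fun z => a z.1 * c z.2
  have hspan : ⊤ ≤ Submodule.span ℂ (Set.range b) := by
    by_contra hne
    obtain ⟨f, hf, hker⟩ := Submodule.exists_le_ker_of_lt_top _
      (lt_top_iff_ne_top.2 fun h => hne h.ge)
    have hfb : ∀ z, f (b z) = 0 := fun z => hker (Submodule.subset_span ⟨z, rfl⟩)
    have hcoef := hW.eq_zero_of_forall_dotProduct (c := fun i => f (Pi.single i 1))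
      fun p hp => by
        rw [← eval_linearForm]
        refine hadamardProduct_subset (isClosed_setOf_eval_eq_zero (isHomogeneous_linearForm _))
          (fun x hx y hy hxy => ?_) hp
        refine (eval_coords_mk_eq_zero_iff (isHomogeneous_linearForm _) _ hxy).2 ?_
        obtain ⟨s, hs⟩ := (ha _).1 (coords_mem_cone.2 hx)
        obtain ⟨t, ht⟩ := (hc _).1 (coords_mem_cone.2 hy)
        rw [f.eval_linearForm_apply_single, hs, ht, Finset.sum_mul_sum, map_sum]
        refine Finset.sum_eq_zero fun i _ => ?_
        rw [map_sum]
        refine Finset.sum_eq_zero fun j _ => ?_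
        rw [smul_mul_smul_comm, map_smul, hfb (i, j), smul_zero]
    refine hf (LinearMap.ext fun v => ?_)
    rw [← f.eval_linearForm_apply_single, hcoef, eval_linearForm, zero_dotProduct,
      LinearMap.zero_apply]
  refine hadamardMapIsIso_of_basis ha hc
    (basisOfTopLeSpanOfCardEqFinrank b hspan (by simp)) fun i j => ?_
  rw [coe_basisOfTopLeSpanOfCardEqFinrank]

end ProjSpace

theorem mainTheorem6 (N d : ℕ) (hd : 1 ≤ d) (hdN : (d : ℝ) < (N : ℝ) / 2)
    (X Y : Set (ProjSpace N)) (hX : ProjSpace.IsVariety X) (hY : ProjSpace.IsVariety Y)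
    (hXdim : ProjSpace.dim X = (d : WithBot ℕ∞)) (hYcodim : ProjSpace.HasCodim Y (d + 1)) :
    ProjSpace.HadamardMapIsIso X Y ↔
      N = 3 ∧ ProjSpace.IsLine X ∧ ProjSpace.IsLine Y ∧
        ProjSpace.IsQuadric (ProjSpace.hadamardProduct X Y) := by
  have hdN' : 2 * d < N := by
    have : (2 * d : ℝ) < N := by linarith
    exact_mod_cast this
  constructor
  · exact fun h => h.isLine_and_isQuadric hd hdN' hX hY hXdim hYcodim
  · rintro ⟨rfl, hXl, hYl, hW⟩
    exact ProjSpace.hadamardMapIsIso_of_isLine hXl hYl hW
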